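/- **Setting.** Let $E\subseteq[n]^2$ be a policy: party $a$ may send to party $b$ if and only if $(a,b)\in E$. An access control encryption (ACE) scheme over $E$ with message space $\mathcal M$, ciphertext space $\mathcal C$ and sanitized ciphertext space $\mathcal C'$ consists of randomized algorithms $(K_0,K_1,\dots,K_n)\leftarrow\mathsf{KeyGen}()$ ($K_0$ for the sanitizer, $K_i$ for party $i$), $C\leftarrow\mathsf{Enc}(a,b,K_a,M)\in\mathcal C$ for $(a,b)\in E$, $C'\leftarrow\mathsf{San}(K_0,C)\in\mathcal C'$, and $\hat M\leftarrow\mathsf{Dec}(a,b,K_b,C')$. Consider the following requirements. * *Correctness*: for all $(a,b)\in E$ and all messages $M\in\mathcal M$, encrypting, sanitizing and decrypting gives $\hat M=M$ with probability one. * *Perfect no-read rule*: for all $(a,b)\in E$ and every random message $M$ independent of the keys, the conditional distribution of $C$ given $(K_i)_{i\in\{0,\dots,n\}\setminus\{a,b\}}=(k_i)_i$ and $M=m$ is uniform on $\mathcal C$, for all values $((k_i)_i,m)$ of positive probability. * *No-write rule with distance parameter $\epsilon$*: for all $A,B\subseteq[n]$ with $(a,b)\notin E$ for all $a\in A$, $b\in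 B$ ($A$ and $B$ may overlap), and every randomized attack $\tilde C\leftarrow\mathsf{Att}(A,B,K_A)$ with values in $\mathcal C$, where $K_A=(K_i)_{i\in A}$, $K_B=(K_i)_{i\in B}$ and $\tilde C'\leftarrow\mathsf{San}(K_0,\tilde C)$, $$\tfrac12\sum_{c',k}\Big|\mathbb P(\tilde C'=c',K_B=k)-\tfrac1{|\mathcal C'|}\,\mathbb P(K_B=k)\Big|\le\epsilon .$$ **Random matrix scheme.** Let $\mathbb F$ be a finite field of order $q$, and let $L\ge1$ and $N>2L$ be integers. Let $\mathcal M=\mathbb F^L\setminus\{\mathbf 0\}$ and $\mathcal C=\mathcal C'=(\mathbb F^N\setminus\{\mathbf 0\})^{E}$. Independently for each $(i,j)\in E$, the key generation samples $(\mathbf K_{\mathrm R,i,j},\mathbf K_{\mathrm E,i,j},\mathbf K_{\mathrm D,i,j})$ uniformly from the triples of full-rank matrices in $\mathbb F^{N\times N}\times\mathbb F^{N\times L}\times\mathbb F^{L\times N}$ with $\mathbf K_{\mathrm D,i,j}\mathbf K_{\mathrm R,i,j}\mathbf K_{\mathrm E,i,j}=\mathbf I_L$. The keys are $K_0=(\mathbf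 K_{\mathrm R,i,j})_{(i,j)\in E}$ and $K_a=\big((\mathbf K_{\mathrm E,a,j})_{j:(a,j)\in E},(\mathbf K_{\mathrm D,i,a})_{i:(i,a)\in E}\big)$. To send $\mathbf m$ to party $b$ with $(a,b)\in E$, party $a$ outputs $(\mathbf c_{i,j})_{(i,j)\in E}$ with $\mathbf c_{a,b}=\mathbf K_{\mathrm E,a,b}\mathbf m$ and all other $\mathbf c_{i,j}$ independent and uniform on $\mathbb F^N\setminus\{\mathbf 0\}$. The sanitizer outputs $(\mathbf c'_{i,j})_{(i,j)\in E}=(\mathbf K_{\mathrm R,i,j}\mathbf c_{i,j})_{(i,j)\in E}$. Party $b$ decrypts $\hat{\mathbf m}=\mathbf K_{\mathrm D,a,b}\mathbf c'_{a,b}$. **Theorem 2.** For every policy $E$, the random matrix scheme is correct, satisfies the perfect no-read rule, and satisfies the no-write rule with distance parameter $$\epsilon=2|E|\,q^{-(N/2-L)}.$$ -/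

import Mathlib

noncomputable section

namespace ACE

universe u

/-! Discrete probability. -/

/-- Statistical distance `(1/2) ∑ₓ |p(x) - q(x)|` of two probability mass functions. -/
def SD {α : Type*} (p q : PMF α) : ℝ :=
  (1 / 2) * ∑' x, |(p x).toReal - (q x).toReal|

/-- Product distribution `p × q`: the law of an independent pair. -/
def prodPMF {α β : Type*} (p : PMF α) (q : PMF β) : PMF (α × β) :=
  p.bind fun x => q.map fun y => (x, y)

/-- Law of a finite family of independent random variables, the `i`-th one having law `p i`. -/
def indepPMF {ι : Type*} [Fintype ι] {α : ι → Type*} [∀ i, Finite (α i)]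
    (p : ∀ i, PMF (α i)) : PMF (∀ i, α i) := by
  classical
  haveI : ∀ i, Fintype (α i) := fun i => Fintype.ofFinite (α i)
  refine PMF.ofFintype (fun x => ∏ i, p i (x i)) ?_
  rw [← Fintype.prod_sum fun i (y : α i) => p i y]
  refine Finset.prod_eq_one fun i _ => ?_
  rw [← tsum_fintype (L := .unconditional _)]
  exact (p i).tsum_coe

/-- The conditional law of `X` given `Y = y`, where `(X, Y)` has law `p` and `ℙ(Y = y) > 0`. -/
def condLaw {α β : Type*} (p : PMF (α × β)) (y : β) (hy : y ∈ (p.map Prod.snd).support) :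
    PMF α :=
  (p.filter {z | z.2 = y} (by
    obtain ⟨z, hz, hzy⟩ := (PMF.mem_support_map_iff _ _ _).1 hy
    exact ⟨z, hzy, hz⟩)).map Prod.fst

/-! Access control encryption, information-theoretic version. -/

/-- The algorithms of an access control encryption scheme for `n` parties and the policy `E`
(party `a` may send to party `b` if and only if `(a, b) ∈ E`). All algorithms may be randomized.
Decryption returns an element of an ambient type `Plain` that contains the message space. The
ciphertext spaces are finite and nonempty, so that they carry uniform distributions. -/
structure Scheme (n : ℕ) (E : Finset (Fin n × Fin n)) : Type (u + 1) where
  /-- ambient type of the message space -/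
  Plain : Type u
  /-- message space -/
  Msg : Set Plain
  /-- ciphertext space -/
  Cipher : Type u
  [fintypeCipher : Fintype Cipher]
  [nonemptyCipher : Nonempty Cipher]
  /-- sanitized ciphertext space -/
  SCipher : Type u
  [fintypeSCipher : Fintype SCipher]
  [nonemptySCipher : Nonempty SCipher]
  /-- the space of sanitizer keys `K₀` -/
  SanKey : Type u
  /-- the space of keys `K_i` of party `i` -/
  Key : Fin n → Type u
  /-- generates `(K₀, (K_i)_i)` -/
  KeyGen : PMF (SanKey × ∀ i, Key i)
  /-- `C ← Enc(a, b, K_a, M)` -/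
  Enc : ∀ a b : Fin n, (a, b) ∈ E → Key a → Msg → PMF Cipher
  /-- `C' ← San(K₀, C)` -/
  San : SanKey → Cipher → PMF SCipher
  /-- `M̂ ← Dec(a, b, K_b, C')` -/
  Dec : ∀ a b : Fin n, (a, b) ∈ E → Key b → SCipher → PMF Plain

namespace Scheme

attribute [instance] fintypeCipher nonemptyCipher fintypeSCipher nonemptySCipher

variable {n : ℕ} {E : Finset (Fin n × Fin n)}

/-- Correctness: if `(a, b) ∈ E`, then `M̂ = M` with probability one, for every message. -/
def Correct (S : Scheme.{u} n E) : Prop :=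
  ∀ (a b : Fin n) (h : (a, b) ∈ E) (m : S.Msg),
    (S.KeyGen.bind fun K =>
      (S.Enc a b h (K.2 a) m).bind fun C =>
        (S.San K.1 C).bind fun C' =>
          S.Dec a b h (K.2 b) C') = PMF.pure (m : S.Plain)

/-- The sanitizer key and the keys of all parties other than `a` and `b`. -/
abbrev OtherKeys (S : Scheme.{u} n E) (a b : Fin n) : Type u :=
  S.SanKey × ∀ i : {i : Fin n // i ≠ a ∧ i ≠ b}, S.Key i

/-- The joint law of `(C, ((K_i)_{i ∈ [0..n] \ {a, b}}, M))` when party `a` encrypts for party `b`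
a message `M` of law `μ` that is independent of the keys. -/
def readLaw (S : Scheme.{u} n E) (a b : Fin n) (h : (a, b) ∈ E) (μ : PMF S.Msg) :
    PMF (S.Cipher × (S.OtherKeys a b × S.Msg)) :=
  S.KeyGen.bind fun K => μ.bind fun m =>
    (S.Enc a b h (K.2 a) m).map fun C => (C, ((K.1, fun i => K.2 i), m))

/-- Perfect no-read rule: given any possible values of the message, of the sanitizer key and of
the keys of all parties other than sender and receiver, the ciphertext is uniform. -/
def PerfectNoRead (S : Scheme.{u} n E) : Prop :=
  ∀ (a b : Fin n) (h : (a, b) ∈ E) (μ : PMF S.Msg) (y : S.OtherKeys a b × S.Msg)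
    (hy : y ∈ ((S.readLaw a b h μ).map Prod.snd).support),
    condLaw (S.readLaw a b h μ) y hy = PMF.uniformOfFintype S.Cipher

/-- The keys of the parties in `A`. -/
abbrev KeysOf (S : Scheme.{u} n E) (A : Finset (Fin n)) : Type u := ∀ i : A, S.Key i

/-- The joint law of `(C̃', K_B)` when the leaker sends `C̃ ← Att(K_A)`. -/
def writeLaw (S : Scheme.{u} n E) (A B : Finset (Fin n)) (Att : S.KeysOf A → PMF S.Cipher) :
    PMF (S.SCipher × S.KeysOf B) :=
  S.KeyGen.bind fun K => (Att fun i => K.2 i).bind fun C =>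
    (S.San K.1 C).map fun C' => (C', fun i => K.2 i)

/-- The law of `K_B`. -/
def keyLaw (S : Scheme.{u} n E) (B : Finset (Fin n)) : PMF (S.KeysOf B) :=
  S.KeyGen.map fun K i => K.2 i

/-- No-write rule with distance parameter `ε`, against every leaker with the keys of `A` and every
listener with the keys of `B`, where nobody in `A` may send to anybody in `B`. The sets `A` and
`B` may overlap, and the (randomized) attack `Att` is arbitrary and may depend on `A` and `B`. -/
def NoWrite (S : Scheme.{u} n E) (ε : ℝ) : Prop :=
  ∀ A B : Finset (Fin n), (∀ a ∈ A, ∀ b ∈ B, (a, b) ∉ E) →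
    ∀ Att : S.KeysOf A → PMF S.Cipher,
      SD (S.writeLaw A B Att) (prodPMF (PMF.uniformOfFintype S.SCipher) (S.keyLaw B)) ≤ ε

end Scheme

/-! The random matrix scheme. -/

section RandomMatrix

variable (F : Type u) [Field F]

/-- `F^N \ {0}`. -/
abbrev NZ (N : ℕ) : Type u := {v : Fin N → F // v ≠ 0}

/-- Full-rank `L × N` matrices. -/
abbrev FR (L N : ℕ) : Type u := {A : Matrix (Fin L) (Fin N) F // A.rank = min L N}

/-- The key space of a single sender-receiver pair: triples `(A_R, A_E, A_D)` of full-rank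
matrices with `A_D A_R A_E = I`. -/
abbrev KeyTriple (L N : ℕ) : Type u :=
  {k : FR F N N × FR F N L × FR F L N // k.2.2.1 * k.1.1 * k.2.1.1 = 1}

variable {F}

theorem mulVec_ne_zero {N L : ℕ} (hLN : L ≤ N) (A : FR F N L) {v : Fin L → F} (hv : v ≠ 0) :
    A.1.mulVec v ≠ 0 := by
  have hr : A.1.rank = L := A.2.trans (min_eq_right hLN)
  have hli : LinearIndependent F A.1.col := by
    rw [linearIndependent_iff_card_eq_finrank_span, Fintype.card_fin, Set.finrank,
      ← Matrix.rank_eq_finrank_span_cols, hr]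
  exact fun h => hv (Matrix.mulVec_injective_iff.2 hli (h.trans (Matrix.mulVec_zero _).symm))

/-- Multiplication of a nonzero vector by a full-rank matrix with at least as many rows as
columns. -/
def mulNZ {N L : ℕ} (hLN : L ≤ N) (A : FR F N L) (v : NZ F L) : NZ F N :=
  ⟨A.1.mulVec v.1, mulVec_ne_zero hLN A v.2⟩

theorem nonempty_NZ {N : ℕ} (hN : 0 < N) : Nonempty (NZ F N) :=
  ⟨⟨fun _ => 1, fun h => one_ne_zero (congrFun h ⟨0, hN⟩)⟩⟩

theorem nonempty_keyTriple {L N : ℕ} (hLN : L ≤ N) : Nonempty (KeyTriple F L N) := by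
  let AE : Matrix (Fin N) (Fin L) F := (1 : Matrix (Fin N) (Fin N) F).submatrix id (Fin.castLE hLN)
  let AD : Matrix (Fin L) (Fin N) F := (1 : Matrix (Fin N) (Fin N) F).submatrix (Fin.castLE hLN) id
  have h1 : AD * AE = 1 := by
    have := Matrix.submatrix_mul (1 : Matrix (Fin N) (Fin N) F) (1 : Matrix (Fin N) (Fin N) F)
      (Fin.castLE hLN) id (Fin.castLE hLN) Function.bijective_id
    rw [← this, Matrix.one_mul]
    exact Matrix.submatrix_one _ (Fin.castLE_injective hLN)
  have h2 : L ≤ AD.rank := by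
    simpa [h1] using Matrix.rank_mul_le_left AD AE
  have h3 : L ≤ AE.rank := by
    simpa [h1] using Matrix.rank_mul_le_right AD AE
  refine ⟨⟨(⟨1, by simp⟩, ⟨AE, ?_⟩, ⟨AD, ?_⟩), by simpa using h1⟩⟩
  · rw [min_eq_right hLN]
    exact le_antisymm (by simpa using AE.rank_le_width) h3
  · rw [min_eq_left hLN]
    exact le_antisymm (by simpa using AD.rank_le_height) h2

variable (F) [Fintype F]

instance (N : ℕ) : Fintype (NZ F N) := Fintype.ofFinite _

/-- Key generation for a single sender-receiver pair: a uniform element of the key space. -/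
def pairKeyGen (L N : ℕ) (hLN : L ≤ N) : PMF (KeyTriple F L N) :=
  haveI : Fintype (KeyTriple F L N) := Fintype.ofFinite _
  haveI : Nonempty (KeyTriple F L N) := nonempty_keyTriple hLN
  PMF.uniformOfFintype (KeyTriple F L N)

/-- The uniform distribution on `F^N \ {0}`. -/
def unifNZ (N : ℕ) (hN : 0 < N) : PMF (NZ F N) :=
  haveI : Nonempty (NZ F N) := nonempty_NZ hN
  PMF.uniformOfFintype (NZ F N)

/-- The random matrix scheme for the policy `E`: one independent key triple for every edge.
The sanitizer holds all `K_R`; party `a` holds `K_E` of the edges that leave `a` and `K_D` of the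
edges that enter `a`. To send `m` to `b`, party `a` puts `K_E m` into the slot `(a, b)` and
independent uniform noise into all other slots. -/
def randomMatrixScheme {n : ℕ} (E : Finset (Fin n × Fin n)) (L N : ℕ) (hN : 2 * L < N) :
    Scheme.{u} n E where
  Plain := Fin L → F
  Msg := {m | m ≠ 0}
  Cipher := E → NZ F N
  nonemptyCipher := haveI := nonempty_NZ (F := F) (N := N) (by lia); inferInstance
  SCipher := E → NZ F N
  nonemptySCipher := haveI := nonempty_NZ (F := F) (N := N) (by lia); inferInstance
  SanKey := E → FR F N N
  Key a := ({j : Fin n // (a, j) ∈ E} → FR F N L) × ({i : Fin n // (i, a) ∈ E} → FR F L N)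
  KeyGen := (indepPMF fun _ : E => pairKeyGen F L N (by lia)).map fun k =>
    (fun e => (k e).1.1,
      fun a => (fun j => (k ⟨(a, j.1), j.2⟩).1.2.1, fun i => (k ⟨(i.1, a), i.2⟩).1.2.2))
  Enc a b h K m := indepPMF fun e : E =>
    if e = ⟨(a, b), h⟩ then PMF.pure (mulNZ (by lia) (K.1 ⟨b, h⟩) m) else unifNZ F N (by lia)
  San K C := PMF.pure fun e => mulNZ le_rfl (K e) (C e)
  Dec a b h K C' := PMF.pure ((K.2 ⟨a, h⟩).1.mulVec (C' ⟨(a, b), h⟩).1)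

end RandomMatrix

end ACE

end

/-!
The random matrix scheme is analysed through the symmetries of the set of key triples
`(R, E, D)` with `D R E = 1`, on which pairs of invertible matrices act by
`(R, E, D) ↦ (g R h⁻¹, h E, D g⁻¹)` (`KeyTriple.act`).

*Correctness* is the equation `D R E m = m`.

*No-read rule.* A reader other than sender and receiver knows `R` but neither `E` nor `D` for the
edge in question. The bijection `(R, E, D) ↦ (R, g E, D R g⁻¹ R⁻¹)` of the keys of this edge
(`KeyTriple.twist`) leaves all other keys alone and turns the ciphertext `E m` into `g E m`. As
`GL_N` acts transitively on nonzero vectors, all ciphertexts are equally likely.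

*No-write rule.* Consider an edge `(i, j)`. If `i ∈ A`, then `j ∉ B`, and it is no loss to let the
leaker know `E, D` and the listener `E`. If `i ∉ A`, then it is no loss to let the leaker know `D`
and the listener `E, D`. The leaker chooses the inputs `c` of all edges as a function of everything
that it knows about all of them, so the edges cannot be treated one after the other. Instead, the
chi-square distance to the ideal law is expanded into a double sum over the leaker's view and an
independent copy of it. Given both views, the outputs are independent between the edges, so that
the double sum is bounded by a product of one-edge collision bounds that hold for *all* choices of
`c` (`sq_sum_abs_sub_le`).

For a single edge, transitivity shows that given `E` and `D`, the vector `R c` is uniform on a fibre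
of `D` if `c` lies in the column space of `E` (`KeyTriple.card_san_le_of_mem_range`), and almost uniform
otherwise (`KeyTriple.card_san_le_of_notMem_range`). If the leaker knows `E` and `D`, the collision bound is
therefore governed by `|ker D ∩ ker D'|` for an independent copy `D'` of `D`, whose mean is computed
by double counting (`KeyTriple.sum_kerInter`). If the leaker knows only `D`, it is governed by the
probability that `c` lies in the column space of `E`. Both collision sums are at most `1 + 3 δ` with
`δ = q^(2L - N)`. Hence the statistical distance is at most `√((1 + 3 δ)^|E| - 1) / 2`, which is at
most `2 |E| √δ` whenever the latter is less than one.
-/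

noncomputable section

namespace ACE

variable {F : Type*} [Field F] {N L : ℕ}

/-! ### Rank-one perturbations of the identity -/

theorem exists_gl_rankOne (u v : Fin N → F) (h : 1 + v ⬝ᵥ u ≠ 0) :
    ∃ g : (Matrix (Fin N) (Fin N) F)ˣ, g.1 = 1 + Matrix.vecMulVec u v := by
  have hdet : IsUnit (1 + Matrix.vecMulVec u v).det := by
    rw [Matrix.vecMulVec_eq Unit, Matrix.det_one_add_mul_comm]
    simpa [Matrix.det_unique, Matrix.mul_apply, dotProduct] using h
  obtain ⟨g, hg⟩ := (Matrix.isUnit_iff_isUnit_det _).2 hdet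
  exact ⟨g, hg⟩

/-- Two nonzero vectors have a common linear functional that vanishes on neither, because a vector
space is not the union of two hyperplanes. -/
theorem exists_dotProduct_ne_zero {x y : Fin N → F} (hx : x ≠ 0) (hy : y ≠ 0) :
    ∃ φ : Fin N → F, φ ⬝ᵥ x ≠ 0 ∧ φ ⬝ᵥ y ≠ 0 := by
  obtain ⟨i, hi⟩ := Function.ne_iff.1 hx
  obtain ⟨j, hj⟩ := Function.ne_iff.1 hy
  by_cases hyi : y i = 0
  · by_cases hxj : x j = 0
    · exact ⟨Pi.single i 1 + Pi.single j 1, by simpa [hxj] using hi, by simpa [hyi] using hj⟩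
    · exact ⟨Pi.single j 1, by simpa using hxj, by simpa using hj⟩
  · exact ⟨Pi.single i 1, by simpa using hi, by simpa using hyi⟩

/-- The stabilizer of `D` in the general linear group acts transitively on the nonzero vectors of
each fibre of `D`. Stated with a single `g` that works for all `D` with `D x = D y`, so that it
contains transitivity on nonzero vectors. -/
theorem exists_gl_mulVec_eq {x y : Fin N → F} (hx : x ≠ 0) (hy : y ≠ 0) :
    ∃ g : (Matrix (Fin N) (Fin N) F)ˣ, g.1.mulVec x = y ∧
      ∀ D : Matrix (Fin L) (Fin N) F, D.mulVec x = D.mulVec y → D * g.1 = D := by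
  obtain ⟨φ, hφx, hφy⟩ := exists_dotProduct_ne_zero hx hy
  obtain ⟨g, hg⟩ := exists_gl_rankOne (y - x) ((φ ⬝ᵥ x)⁻¹ • φ) (by
    rw [smul_dotProduct, dotProduct_sub, smul_eq_mul, mul_sub, inv_mul_cancel₀ hφx]
    simpa using ⟨hφx, hφy⟩)
  refine ⟨g, ?_, fun D hD => ?_⟩
  · rw [hg, Matrix.add_mulVec, Matrix.one_mulVec, Matrix.vecMulVec_mulVec, smul_dotProduct,
      smul_eq_mul, inv_mul_cancel₀ hφx]
    simp
  · rw [hg, Matrix.mul_add, Matrix.mul_one, Matrix.mul_vecMulVec, Matrix.mulVec_sub, hD]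
    simp

/-- A shear along the column space of `E` fixes `E` and moves a vector outside of the column space
by a prescribed vector of the column space. -/
theorem exists_gl_shear (E : Matrix (Fin N) (Fin L) F) {c : Fin N → F}
    (hc : ∀ m, E.mulVec m ≠ c) (z : Fin L → F) :
    ∃ h : (Matrix (Fin N) (Fin N) F)ˣ, h.1 * E = E ∧ h.1.mulVec c = c + E.mulVec z := by
  obtain ⟨f, hfc, hfE⟩ := (LinearMap.range E.mulVecLin).exists_le_ker_of_notMem (v := c)
    (fun ⟨m, hm⟩ => hc m hm)
  set ψ : Fin N → F := fun i => (f c)⁻¹ * f (Pi.single i 1) with hψ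
  have hψf : ∀ x, ψ ⬝ᵥ x = (f c)⁻¹ * f x := by
    intro x
    conv_rhs => rw [LinearMap.pi_apply_eq_sum_univ f x]
    simp only [dotProduct, hψ, Finset.mul_sum, smul_eq_mul]
    refine Finset.sum_congr rfl fun i _ => ?_
    have : (fun j => if i = j then (1 : F) else 0) = Pi.single i 1 := by
      ext j; simp [Pi.single_apply, eq_comm]
    rw [this]; ring
  have hψE : ∀ m, ψ ⬝ᵥ E.mulVec m = 0 := fun m => by
    have : f (E.mulVec m) = 0 := hfE ⟨m, rfl⟩
    rw [hψf, this, mul_zero]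
  have hψE' : Matrix.vecMul ψ E = 0 := by
    ext j
    have := hψE (Pi.single j 1)
    rw [Matrix.dotProduct_mulVec] at this
    simpa using this
  obtain ⟨h, hh⟩ := exists_gl_rankOne (E.mulVec z) ψ (by simp [hψE])
  refine ⟨h, ?_, ?_⟩
  · rw [hh, Matrix.add_mul, Matrix.one_mul, Matrix.vecMulVec_mul, hψE']
    ext i j
    simp [Matrix.vecMulVec_apply]
  · rw [hh, Matrix.add_mulVec, Matrix.one_mulVec, Matrix.vecMulVec_mulVec, hψf,
      inv_mul_cancel₀ hfc]
    simp

/-! ### Symmetries of the key space -/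

/-- Left multiplication of a full-rank matrix by an invertible matrix. -/
def FR.lmul {M N : ℕ} (g : (Matrix (Fin M) (Fin M) F)ˣ) (A : FR F M N) : FR F M N :=
  ⟨g.1 * A.1, by
    rw [Matrix.rank_mul_eq_right_of_isUnit_det _ _
      ((Matrix.isUnit_iff_isUnit_det _).1 g.isUnit), A.2]⟩

/-- Right multiplication of a full-rank matrix by an invertible matrix. -/
def FR.rmul {M N : ℕ} (A : FR F M N) (g : (Matrix (Fin N) (Fin N) F)ˣ) : FR F M N :=
  ⟨A.1 * g.1, by
    rw [Matrix.rank_mul_eq_left_of_isUnit_det _ _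
      ((Matrix.isUnit_iff_isUnit_det _).1 g.isUnit), A.2]⟩

theorem FR.isUnit (A : FR F N N) : IsUnit A.1 := by
  rw [← Matrix.mulVec_injective_iff_isUnit]
  refine (injective_iff_map_eq_zero A.1.mulVecLin).2 fun v hv => ?_
  by_contra h
  exact mulVec_ne_zero le_rfl A h hv

/-- A square full-rank matrix as a unit of the matrix ring. -/
def FR.unit (A : FR F N N) : (Matrix (Fin N) (Fin N) F)ˣ := A.isUnit.unit

theorem FR.val_unit (A : FR F N N) : (A.unit : Matrix (Fin N) (Fin N) F) = A.1 :=
  A.isUnit.unit_spec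

namespace KeyTriple

/-- The sanitizer matrix of a key triple. -/
abbrev r (t : KeyTriple F L N) : FR F N N := t.1.1

/-- The encryption matrix of a key triple. -/
abbrev e (t : KeyTriple F L N) : FR F N L := t.1.2.1

/-- The decryption matrix of a key triple. -/
abbrev d (t : KeyTriple F L N) : FR F L N := t.1.2.2

theorem d_r_e (t : KeyTriple F L N) : t.d.1 * t.r.1 * t.e.1 = 1 := t.2

theorem ext' {s t : KeyTriple F L N} (hr : s.r.1 = t.r.1) (he : s.e.1 = t.e.1)
    (hd : s.d.1 = t.d.1) : s = t :=
  Subtype.ext (Prod.ext (Subtype.ext hr) (Prod.ext (Subtype.ext he) (Subtype.ext hd)))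

theorem d_r_e_mulVec (t : KeyTriple F L N) (m : Fin L → F) :
    t.d.1.mulVec (t.r.1.mulVec (t.e.1.mulVec m)) = m := by
  rw [Matrix.mulVec_mulVec, Matrix.mulVec_mulVec, t.d_r_e, Matrix.one_mulVec]

theorem d_surjective (t : KeyTriple F L N) : Function.Surjective t.d.1.mulVec :=
  fun m => ⟨_, t.d_r_e_mulVec m⟩

/-- The action `(R, E, D) ↦ (g R h⁻¹, h E, D g⁻¹)` of pairs of invertible matrices on the key
space. -/
def act (g h : (Matrix (Fin N) (Fin N) F)ˣ) : KeyTriple F L N ≃ KeyTriple F L N where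
  toFun t := ⟨((t.r.lmul g).rmul h⁻¹, t.e.lmul h, t.d.rmul g⁻¹), by
    have := t.d_r_e
    simp only [FR.lmul, FR.rmul]
    calc _ = t.d.1 * ((g⁻¹).1 * g.1) * t.r.1 * ((h⁻¹).1 * h.1) * t.e.1 := by
            simp only [Matrix.mul_assoc]
      _ = 1 := by simp [this]⟩
  invFun t := ⟨((t.r.lmul g⁻¹).rmul h, t.e.lmul h⁻¹, t.d.rmul g), by
    have := t.d_r_e
    simp only [FR.lmul, FR.rmul]
    calc _ = t.d.1 * (g.1 * (g⁻¹).1) * t.r.1 * (h.1 * (h⁻¹).1) * t.e.1 := by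
            simp only [Matrix.mul_assoc]
      _ = 1 := by simp [this]⟩
  left_inv t := by
    refine ext' ?_ ?_ ?_ <;> simp [FR.lmul, FR.rmul, Matrix.mul_assoc]
  right_inv t := by
    refine ext' ?_ ?_ ?_ <;> simp [FR.lmul, FR.rmul, Matrix.mul_assoc]

/-- The map `(R, E, D) ↦ (R, g E, D R g⁻¹ R⁻¹)`. -/
def twistFun (g : (Matrix (Fin N) (Fin N) F)ˣ) (t : KeyTriple F L N) : KeyTriple F L N :=
  ⟨(t.r, t.e.lmul g, t.d.rmul (t.r.unit * g⁻¹ * t.r.unit⁻¹)), by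
    have := t.d_r_e
    rw [← t.r.val_unit] at this
    simp only [FR.lmul, FR.rmul]
    calc _ = t.d.1 * (t.r.unit * g⁻¹ * t.r.unit⁻¹ * t.r.unit * g).1 * t.e.1 := by
            simp only [Units.val_mul, Matrix.mul_assoc, t.r.val_unit]
      _ = 1 := by rw [← this]; congr 3; group⟩

theorem twistFun_twistFun {g h : (Matrix (Fin N) (Fin N) F)ˣ} (hgh : h * g = 1)
    (t : KeyTriple F L N) : twistFun h (twistFun g t) = t := by
  refine ext' rfl ?_ ?_
  · change h.1 * (g.1 * t.e.1) = t.e.1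
    rw [← Matrix.mul_assoc, ← Units.val_mul, hgh, Units.val_one, Matrix.one_mul]
  · change t.d.1 * (t.r.unit * g⁻¹ * t.r.unit⁻¹).1 * (t.r.unit * h⁻¹ * t.r.unit⁻¹).1 = t.d.1
    rw [Matrix.mul_assoc, ← Units.val_mul]
    have : t.r.unit * g⁻¹ * t.r.unit⁻¹ * (t.r.unit * h⁻¹ * t.r.unit⁻¹) = 1 := by
      rw [eq_inv_of_mul_eq_one_left hgh]; group
    rw [this, Units.val_one, Matrix.mul_one]

/-- The symmetry `(R, E, D) ↦ (R, g E, D R g⁻¹ R⁻¹)` of the key space, which fixes the sanitizer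
matrix. -/
def twist (g : (Matrix (Fin N) (Fin N) F)ˣ) : KeyTriple F L N ≃ KeyTriple F L N where
  toFun := twistFun g
  invFun := twistFun g⁻¹
  left_inv := twistFun_twistFun (inv_mul_cancel g)
  right_inv := twistFun_twistFun (mul_inv_cancel g)

theorem mulNZ_twist_eq_iff (hLN : L ≤ N) {g : (Matrix (Fin N) (Fin N) F)ˣ}
    (t : KeyTriple F L N) (m : NZ F L) {c c' : NZ F N} (hg : g.1.mulVec c.1 = c'.1) :
    mulNZ hLN (twist g t).e m = c' ↔ mulNZ hLN t.e m = c := by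
  rw [Subtype.ext_iff, Subtype.ext_iff, ← hg]
  change (g.1 * t.e.1).mulVec m.1 = g.1.mulVec c.1 ↔ t.e.1.mulVec m.1 = c.1
  rw [← Matrix.mulVec_mulVec]
  exact (Matrix.mulVec_injective_iff_isUnit.2 g.isUnit).eq_iff

end KeyTriple

open scoped Classical
open Finset

variable [Fintype F]

instance : Fintype (KeyTriple F L N) := Fintype.ofFinite _

/-! ### Counting keys -/

theorem card_NZ_add_one (N : ℕ) : Fintype.card (NZ F N) + 1 = Fintype.card F ^ N := by
  have h : Fintype.card {v : Fin N → F // ¬ v = 0} = _ := Fintype.card_subtype_compl _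
  have h2 : Fintype.card (NZ F N) = Fintype.card {v : Fin N → F // ¬ v = 0} :=
    Fintype.card_congr (Equiv.refl _)
  rw [h2, h, Fintype.card_subtype_eq, Fintype.card_fun, Fintype.card_fin,
    Nat.sub_add_cancel (Nat.one_le_pow _ _ Fintype.card_pos)]

namespace KeyTriple

theorem card_d_fiber (hLN : L ≤ N) (t : KeyTriple F L N) (u : Fin L → F) :
    #{x : Fin N → F | t.d.1.mulVec x = u} = Fintype.card F ^ (N - L) := by
  have key : ∀ v : Fin L → F, #{x : Fin N → F | t.d.1.mulVec x = v} =
      #{x : Fin N → F | t.d.1.mulVec x = u} := fun v =>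
    AddMonoidHom.card_fiber_eq_of_mem_range t.d.1.mulVecLin.toAddMonoidHom
      (t.d_surjective v) (t.d_surjective u)
  have h := card_eq_sum_card_fiberwise (f := t.d.1.mulVec) (s := univ) (t := univ)
    (fun _ _ => by simp)
  simp only [key, sum_const, card_univ, Fintype.card_fun, Fintype.card_fin, smul_eq_mul] at h
  have hq : 0 < Fintype.card F ^ L := pow_pos Fintype.card_pos _
  have hN : Fintype.card F ^ N = Fintype.card F ^ L * Fintype.card F ^ (N - L) := by
    rw [← pow_add, Nat.add_sub_of_le hLN]
  exact (Nat.eq_of_mul_eq_mul_left hq (hN.symm.trans h)).symm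

/-- A fibre of `D` inside `F^N \ {0}` is a fibre of `D`, up to the zero vector. -/
theorem le_card_d_fiber_NZ (hLN : L ≤ N) (t : KeyTriple F L N) (u : Fin L → F) :
    Fintype.card F ^ (N - L) ≤ #{x : NZ F N | t.d.1.mulVec x.1 = u} + if u = 0 then 1 else 0 := by
  rw [← t.card_d_fiber hLN u, ← card_map (Function.Embedding.subtype _)]
  split_ifs with h
  · refine le_trans (card_le_card (t := insert 0 _) fun x hx => ?_) (card_insert_le _ _)
    by_cases hx0 : x = 0 <;> simp_all
  · refine card_le_card fun x hx => ?_
    have hx0 : x ≠ 0 := by rintro rfl; simp_all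
    simp_all

theorem card_d_ker_NZ (hLN : L ≤ N) (t : KeyTriple F L N) :
    #{x : NZ F N | t.d.1.mulVec x.1 = 0} + 1 = Fintype.card F ^ (N - L) := by
  refine le_antisymm ?_ (by simpa using t.le_card_d_fiber_NZ hLN 0)
  rw [← t.card_d_fiber hLN 0, ← card_map (Function.Embedding.subtype _),
    ← card_insert_of_notMem (a := 0) (by simp)]
  refine card_le_card fun x hx => ?_
  simp only [mem_insert, mem_map, mem_filter, mem_univ, true_and] at hx ⊢
  rcases hx with rfl | ⟨y, hy, rfl⟩
  · simp
  · exact hy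

theorem card_e_range_NZ (hLN : L ≤ N) (t : KeyTriple F L N) :
    #{c : NZ F N | ∃ m, t.e.1.mulVec m = c.1} + 1 = Fintype.card F ^ L := by
  rw [← card_NZ_add_one, ← card_univ]
  congr 1
  symm
  refine card_bij (fun m _ => mulNZ hLN t.e m) (fun m _ => by simpa using ⟨m.1, rfl⟩)
    (fun m _ m' _ h => ?_) (fun c hc => ?_)
  · have h1 : t.e.1.mulVec m.1 = t.e.1.mulVec m'.1 := congrArg Subtype.val h
    have h2 := t.d_r_e_mulVec m.1
    rw [h1, t.d_r_e_mulVec] at h2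
    exact Subtype.ext h2.symm
  · obtain ⟨m, hm⟩ := (mem_filter.1 hc).2
    refine ⟨⟨m, ?_⟩, mem_univ _, Subtype.ext hm⟩
    rintro rfl
    exact c.2 (by rw [← hm, Matrix.mulVec_zero])

/-- The number of keys with given encryption and decryption matrices that send the ciphertext `c`
to the sanitized ciphertext `x` depends only on the decryption of `x`. -/
theorem card_san_eq (E₀ : FR F N L) (D₀ : FR F L N) (c : NZ F N) {x y : NZ F N}
    (h : D₀.1.mulVec x.1 = D₀.1.mulVec y.1) :
    #{t : KeyTriple F L N | (t.e = E₀ ∧ t.d = D₀) ∧ mulNZ le_rfl t.r c = x} =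
      #{t : KeyTriple F L N | (t.e = E₀ ∧ t.d = D₀) ∧ mulNZ le_rfl t.r c = y} := by
  have key : ∀ x y : NZ F N, D₀.1.mulVec x.1 = D₀.1.mulVec y.1 →
      #{t : KeyTriple F L N | (t.e = E₀ ∧ t.d = D₀) ∧ mulNZ le_rfl t.r c = x} ≤
      #{t : KeyTriple F L N | (t.e = E₀ ∧ t.d = D₀) ∧ mulNZ le_rfl t.r c = y} := by
    intro x y h
    obtain ⟨g, hgx, hgD⟩ := exists_gl_mulVec_eq (L := L) y.2 x.2
    refine card_le_card_of_injOn (act g⁻¹ 1) (fun t ht => ?_) (act g⁻¹ 1).injective.injOn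
    simp only [coe_filter, mem_univ, true_and, Set.mem_ofPred_eq] at ht ⊢
    obtain ⟨⟨rfl, rfl⟩, rfl⟩ := ht
    refine ⟨⟨Subtype.ext ?_, Subtype.ext ?_⟩, Subtype.ext ?_⟩
    · simp [act, FR.lmul]
    · simpa [act, FR.rmul] using hgD _ h.symm
    · simp only [mulNZ] at hgx
      simp only [act, FR.rmul, FR.lmul, mulNZ, Equiv.coe_fn_mk, inv_one, Units.val_one,
        Matrix.mul_one]
      rw [← Matrix.mulVec_mulVec, ← hgx, Matrix.mulVec_mulVec, ← Units.val_mul, inv_mul_cancel,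
        Units.val_one, Matrix.one_mulVec]
  exact le_antisymm (key x y h) (key y x h.symm)

theorem card_san_mul_card_d_fiber (E₀ : FR F N L) (D₀ : FR F L N) (c x : NZ F N) :
    #{t : KeyTriple F L N | (t.e = E₀ ∧ t.d = D₀) ∧ mulNZ le_rfl t.r c = x} *
      #{y : NZ F N | D₀.1.mulVec y.1 = D₀.1.mulVec x.1} =
    #{t : KeyTriple F L N | (t.e = E₀ ∧ t.d = D₀) ∧
      D₀.1.mulVec (t.r.1.mulVec c.1) = D₀.1.mulVec x.1} := by
  have h := card_eq_sum_card_fiberwise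
    (s := {t : KeyTriple F L N | (t.e = E₀ ∧ t.d = D₀) ∧
      D₀.1.mulVec (t.r.1.mulVec c.1) = D₀.1.mulVec x.1})
    (f := fun t : KeyTriple F L N => mulNZ le_rfl t.r c)
    (t := {y : NZ F N | D₀.1.mulVec y.1 = D₀.1.mulVec x.1})
    (fun t ht => by
      have := (mem_filter.1 (mem_coe.1 ht)).2.2
      exact mem_coe.2 (mem_filter.2 ⟨mem_univ _, this⟩))
  rw [h, mul_comm, ← smul_eq_mul, ← sum_const]
  refine sum_congr rfl fun y hy => ?_
  have hy : D₀.1.mulVec y.1 = D₀.1.mulVec x.1 := by simpa using hy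
  rw [card_san_eq E₀ D₀ c hy.symm, filter_filter]
  congr 1
  ext t
  simp only [mem_filter, mem_univ, true_and]
  refine ⟨fun h => ⟨⟨h.1, ?_⟩, h.2⟩, fun h => ⟨h.1.1, h.2⟩⟩
  rw [← hy, ← h.2]; rfl

/-- A ciphertext in the column space of the encryption matrix is sanitized to a vector that is
uniform on a fibre of the decryption matrix. -/
theorem card_san_le_of_mem_range (hLN : L ≤ N) (E₀ : FR F N L) (D₀ : FR F L N) {c : NZ F N}
    {m : Fin L → F} (hc : E₀.1.mulVec m = c.1) (x : NZ F N) :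
    #{t : KeyTriple F L N | (t.e = E₀ ∧ t.d = D₀) ∧ mulNZ le_rfl t.r c = x} *
      Fintype.card F ^ (N - L) ≤ #{t : KeyTriple F L N | t.e = E₀ ∧ t.d = D₀} := by
  by_cases h : ∃ t : KeyTriple F L N, (t.e = E₀ ∧ t.d = D₀) ∧ mulNZ le_rfl t.r c = x
  · obtain ⟨t, ⟨rfl, rfl⟩, hx⟩ := h
    have hm : t.d.1.mulVec x.1 = m := by
      rw [← hx]
      simp only [mulNZ]
      rw [← hc, t.d_r_e_mulVec]
    have hm0 : m ≠ 0 := by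
      rintro rfl
      exact c.2 (by rw [← hc, Matrix.mulVec_zero])
    have h1 := t.le_card_d_fiber_NZ hLN m
    rw [if_neg hm0, add_zero, ← hm] at h1
    refine (Nat.mul_le_mul_left _ h1).trans ?_
    rw [card_san_mul_card_d_fiber]
    exact card_le_card fun s => by simp +contextual
  · rw [filter_eq_empty_iff.2 fun t _ ht => h ⟨t, ht⟩]
    simp

/-- A ciphertext outside of the column space of the encryption matrix is sanitized to a vector
whose decryption is uniform on `F^L`. -/
theorem card_san_le_of_notMem_range (hLN : L ≤ N) (E₀ : FR F N L) (D₀ : FR F L N) {c : NZ F N}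
    (hc : ∀ m, E₀.1.mulVec m ≠ c.1) (x : NZ F N) :
    #{t : KeyTriple F L N | (t.e = E₀ ∧ t.d = D₀) ∧ mulNZ le_rfl t.r c = x} *
      (Fintype.card F ^ L * (Fintype.card F ^ (N - L) - 1)) ≤
        #{t : KeyTriple F L N | t.e = E₀ ∧ t.d = D₀} := by
  by_cases h : ∃ t : KeyTriple F L N, (t.e = E₀ ∧ t.d = D₀) ∧ mulNZ le_rfl t.r c = x
  · obtain ⟨t, ⟨rfl, rfl⟩, -⟩ := h
    have h1 : Fintype.card F ^ (N - L) - 1 ≤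
        #{y : NZ F N | t.d.1.mulVec y.1 = t.d.1.mulVec x.1} := by
      have := t.le_card_d_fiber_NZ hLN (t.d.1.mulVec x.1)
      split_ifs at this <;> lia
    rw [mul_comm (Fintype.card F ^ L), ← mul_assoc]
    refine (Nat.mul_le_mul_right _ (Nat.mul_le_mul_left _ h1)).trans ?_
    rw [card_san_mul_card_d_fiber]
    have key : ∀ u v : Fin L → F,
        #{s : KeyTriple F L N | (s.e = t.e ∧ s.d = t.d) ∧
          t.d.1.mulVec (s.r.1.mulVec c.1) = u} ≤
        #{s : KeyTriple F L N | (s.e = t.e ∧ s.d = t.d) ∧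
          t.d.1.mulVec (s.r.1.mulVec c.1) = v} := by
      intro u v
      obtain ⟨h, hE, hhc⟩ := exists_gl_shear t.e.1 hc (v - u)
      refine card_le_card_of_injOn (act 1 h⁻¹) (fun s hs => ?_) (act 1 h⁻¹).injective.injOn
      simp only [coe_filter, mem_univ, true_and, Set.mem_ofPred_eq] at hs ⊢
      obtain ⟨⟨he, hd⟩, hs⟩ := hs
      refine ⟨⟨Subtype.ext ?_, Subtype.ext ?_⟩, ?_⟩
      · simp only [act, FR.lmul, Equiv.coe_fn_mk]
        rw [he]
        nth_rw 1 [← hE]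
        rw [← Matrix.mul_assoc, ← Units.val_mul, inv_mul_cancel, Units.val_one, Matrix.one_mul]
      · simp [act, FR.rmul, hd]
      · have h2 := s.d_r_e_mulVec (v - u)
        rw [he, hd] at h2
        simp only [act, FR.rmul, FR.lmul, Equiv.coe_fn_mk, Units.val_one, Matrix.one_mul, inv_inv]
        rw [← Matrix.mulVec_mulVec, hhc, Matrix.mulVec_add, Matrix.mulVec_add, h2, hs]
        simp
    have h2 := card_eq_sum_card_fiberwise (s := {s : KeyTriple F L N | s.e = t.e ∧ s.d = t.d})
      (f := fun s : KeyTriple F L N => t.d.1.mulVec (s.r.1.mulVec c.1)) (t := univ)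
      (fun _ _ => by simp)
    simp only [filter_filter] at h2
    rw [h2]
    have h3 := card_nsmul_le_sum univ (fun u : Fin L → F =>
      #{s : KeyTriple F L N | (s.e = t.e ∧ s.d = t.d) ∧ t.d.1.mulVec (s.r.1.mulVec c.1) = u})
      _ (fun u _ => key (t.d.1.mulVec x.1) u)
    simpa [mul_comm] using h3
  · rw [filter_eq_empty_iff.2 fun t _ ht => h ⟨t, ht⟩]
    simp

/-- Given the encryption matrix, a fixed nonzero vector lies in the kernel of the decryption matrix
as often as the average nonzero vector does. -/
theorem card_e_eq_and_d_mulVec_eq_zero (hLN : L ≤ N) (E₀ : FR F N L) (x : NZ F N) :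
    Fintype.card (NZ F N) * #{t : KeyTriple F L N | t.e = E₀ ∧ t.d.1.mulVec x.1 = 0} =
      (Fintype.card F ^ (N - L) - 1) * #{t : KeyTriple F L N | t.e = E₀} := by
  have key : ∀ x y : NZ F N, #{t : KeyTriple F L N | t.e = E₀ ∧ t.d.1.mulVec x.1 = 0} ≤
      #{t : KeyTriple F L N | t.e = E₀ ∧ t.d.1.mulVec y.1 = 0} := by
    intro x y
    obtain ⟨g, hg, -⟩ := exists_gl_mulVec_eq (L := L) y.2 x.2
    refine card_le_card_of_injOn (act g⁻¹ 1) (fun t ht => ?_) (act g⁻¹ 1).injective.injOn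
    simp only [coe_filter, mem_univ, true_and, Set.mem_ofPred_eq] at ht ⊢
    refine ⟨Subtype.ext ?_, ?_⟩
    · simp [act, FR.lmul, ht.1]
    · simp [act, FR.rmul, ← Matrix.mulVec_mulVec, hg, ht.2]
  have h := sum_card_bipartiteAbove_eq_sum_card_bipartiteBelow
    (s := (univ : Finset (NZ F N))) (t := {t : KeyTriple F L N | t.e = E₀})
    (fun x t => t.d.1.mulVec x.1 = 0)
  simp only [bipartiteAbove, bipartiteBelow, filter_filter] at h
  rw [sum_congr rfl fun y _ => le_antisymm (key y x) (key x y),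
    sum_congr rfl fun t _ => Nat.eq_sub_of_add_eq (card_d_ker_NZ hLN t), sum_const, sum_const,
    card_univ, smul_eq_mul, smul_eq_mul] at h
  rw [h, mul_comm]

/-- Given the decryption matrix, a fixed nonzero vector lies in the column space of the encryption
matrix as often as the average nonzero vector does. -/
theorem card_d_eq_and_mem_range_e (hLN : L ≤ N) (D₀ : FR F L N) (c : NZ F N) :
    Fintype.card (NZ F N) * #{t : KeyTriple F L N | t.d = D₀ ∧ ∃ m, t.e.1.mulVec m = c.1} =
      (Fintype.card F ^ L - 1) * #{t : KeyTriple F L N | t.d = D₀} := by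
  have key : ∀ x y : NZ F N, #{t : KeyTriple F L N | t.d = D₀ ∧ ∃ m, t.e.1.mulVec m = x.1} ≤
      #{t : KeyTriple F L N | t.d = D₀ ∧ ∃ m, t.e.1.mulVec m = y.1} := by
    intro x y
    obtain ⟨h, hh, -⟩ := exists_gl_mulVec_eq (L := L) x.2 y.2
    refine card_le_card_of_injOn (act 1 h) (fun t ht => ?_) (act 1 h).injective.injOn
    simp only [coe_filter, mem_univ, true_and, Set.mem_ofPred_eq] at ht ⊢
    obtain ⟨hd, m, hm⟩ := ht
    refine ⟨Subtype.ext ?_, m, ?_⟩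
    · simp [act, FR.rmul, hd]
    · simp [act, FR.lmul, ← Matrix.mulVec_mulVec, hm, hh]
  have h := sum_card_bipartiteAbove_eq_sum_card_bipartiteBelow
    (s := (univ : Finset (NZ F N))) (t := {t : KeyTriple F L N | t.d = D₀})
    (fun x t => ∃ m, t.e.1.mulVec m = x.1)
  simp only [bipartiteAbove, bipartiteBelow, filter_filter] at h
  rw [sum_congr rfl fun y _ => le_antisymm (key y c) (key c y),
    sum_congr rfl fun t _ => Nat.eq_sub_of_add_eq (card_e_range_NZ hLN t), sum_const, sum_const,
    card_univ, smul_eq_mul, smul_eq_mul] at h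
  rw [h, mul_comm]

end KeyTriple

/-! ### Collision bounds for a single pair of parties -/

variable (F) in
/-- The number `q^(2L - N)`, whose square root governs the statistical distance of the scheme
from an ideal one. -/
def leak (L N : ℕ) : ℝ := (Fintype.card F : ℝ) ^ L / (Fintype.card F : ℝ) ^ (N - L)

theorem two_le_card_pow (hL : 1 ≤ L) : (2 : ℝ) ≤ (Fintype.card F : ℝ) ^ L := by
  have h : 2 ≤ Fintype.card F ^ L :=
    (Fintype.one_lt_card (α := F)).trans_le (Nat.le_self_pow (by lia) _)
  exact_mod_cast h

theorem two_mul_card_pow_le (hN : 2 * L < N) :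
    2 * (Fintype.card F : ℝ) ^ L ≤ (Fintype.card F : ℝ) ^ (N - L) := by
  have h2 : (2 : ℝ) ≤ (Fintype.card F : ℝ) ^ (N - L - L) := two_le_card_pow (by lia)
  have h : (Fintype.card F : ℝ) ^ (N - L) =
      (Fintype.card F : ℝ) ^ (N - L - L) * (Fintype.card F : ℝ) ^ L := by
    rw [← pow_add]; congr 1; lia
  rw [h]
  gcongr

theorem cast_card_NZ (hLN : L ≤ N) : (Fintype.card (NZ F N) : ℝ) =
    (Fintype.card F : ℝ) ^ L * (Fintype.card F : ℝ) ^ (N - L) - 1 := by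
  rw [← pow_add, Nat.add_sub_of_le hLN, eq_sub_iff_add_eq]
  exact_mod_cast card_NZ_add_one N

/-- The number of common zeros of two matrices. -/
def kerInter (D D' : FR F L N) : ℕ := #{x : Fin N → F | D.1.mulVec x = 0 ∧ D'.1.mulVec x = 0}

theorem card_inter_fiber_le (D D' : FR F L N) (m m' : Fin L → F) :
    #{x : Fin N → F | D.1.mulVec x = m ∧ D'.1.mulVec x = m'} ≤ kerInter D D' := by
  by_cases h : ∃ x₀ : Fin N → F, D.1.mulVec x₀ = m ∧ D'.1.mulVec x₀ = m'
  · obtain ⟨x₀, rfl, rfl⟩ := h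
    refine card_le_card_of_injOn (· - x₀) (fun x hx => ?_) (sub_left_injective.injOn)
    simp only [coe_filter, mem_univ, true_and, Set.mem_ofPred_eq] at hx ⊢
    simp [Matrix.mulVec_sub, hx]
  · rw [filter_eq_empty_iff.2 fun x _ hx => h ⟨x, hx⟩]
    simp

namespace KeyTriple

theorem card_pow_le_kerInter (hLN : L ≤ N) (t : KeyTriple F L N) (D' : FR F L N) :
    Fintype.card F ^ (N - L) ≤ kerInter t.d D' * Fintype.card F ^ L := by
  rw [← t.card_d_fiber hLN 0]
  have h := card_le_mul_card_image_of_maps_to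
    (s := {x : Fin N → F | t.d.1.mulVec x = 0}) (t := univ) (f := D'.1.mulVec)
    (fun _ _ => mem_univ _) (kerInter t.d D') (fun b _ => by
      rw [filter_filter]; exact card_inter_fiber_le _ _ _ _)
  simpa using h

/-- The mean of `|ker D ∩ ker D'|` over the keys with the same encryption matrix, by counting for
each `x` in the kernel of `D` the keys with `D' x = 0`. -/
theorem sum_kerInter (hLN : L ≤ N) (t : KeyTriple F L N) :
    (Fintype.card (NZ F N) : ℝ) * ∑ s : KeyTriple F L N with s.e = t.e, (kerInter t.d s.d : ℝ) =
      #{s : KeyTriple F L N | s.e = t.e} *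
        (Fintype.card (NZ F N) + ((Fintype.card F : ℝ) ^ (N - L) - 1) ^ 2) := by
  have h := sum_card_bipartiteAbove_eq_sum_card_bipartiteBelow
    (s := {x : Fin N → F | t.d.1.mulVec x = 0})
    (t := {s : KeyTriple F L N | s.e = t.e}) (fun x s => s.d.1.mulVec x = 0)
  simp only [bipartiteAbove, bipartiteBelow, filter_filter] at h
  have h0 : ({x : Fin N → F | t.d.1.mulVec x = 0} : Finset _) =
      insert 0 (({x : NZ F N | t.d.1.mulVec x.1 = 0} : Finset _).map
        (Function.Embedding.subtype _)) := by
    ext x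
    by_cases hx : x = 0 <;> simp [hx]
  rw [h0, sum_insert (by simp), sum_map] at h
  simp only [Matrix.mulVec_zero, and_true] at h
  replace h : #{s : KeyTriple F L N | s.e = t.e} + ∑ x : NZ F N with t.d.1.mulVec x.1 = 0,
      #{s : KeyTriple F L N | s.e = t.e ∧ s.d.1.mulVec x.1 = 0} =
      ∑ s : KeyTriple F L N with s.e = t.e, kerInter t.d s.d := h
  have h1 : Fintype.card (NZ F N) * ∑ x : NZ F N with t.d.1.mulVec x.1 = 0,
      #{s : KeyTriple F L N | s.e = t.e ∧ s.d.1.mulVec x.1 = 0} =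
      (Fintype.card F ^ (N - L) - 1) * ((Fintype.card F ^ (N - L) - 1) *
        #{s : KeyTriple F L N | s.e = t.e}) := by
    rw [mul_sum, sum_congr rfl fun x _ => card_e_eq_and_d_mulVec_eq_zero hLN t.e x, sum_const,
      Nat.eq_sub_of_add_eq (t.card_d_ker_NZ hLN), smul_eq_mul]
  have hB : 1 ≤ Fintype.card F ^ (N - L) := Nat.one_le_pow _ _ Fintype.card_pos
  have h2 : Fintype.card (NZ F N) * ∑ s : KeyTriple F L N with s.e = t.e, kerInter t.d s.d =
      #{s : KeyTriple F L N | s.e = t.e} *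
        (Fintype.card (NZ F N) + (Fintype.card F ^ (N - L) - 1) ^ 2) := by
    rw [← h, mul_add, h1]; ring
  have h3 := congrArg (Nat.cast : ℕ → ℝ) h2
  push_cast [Nat.cast_sub hB] at h3
  exact h3

/-- The bound for ciphertexts outside of the column space, compared with the uniform distribution
on the nonzero vectors. -/
theorem card_NZ_mul_card_san_le (hL : 1 ≤ L) (hN : 2 * L < N) (E₀ : FR F N L)
    (D₀ : FR F L N) {c : NZ F N} (hc : ∀ m, E₀.1.mulVec m ≠ c.1) (x : NZ F N) :
    (Fintype.card (NZ F N) : ℝ) *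
      #{t : KeyTriple F L N | (t.e = E₀ ∧ t.d = D₀) ∧ mulNZ le_rfl t.r c = x} ≤
    (1 + leak F L N) * #{t : KeyTriple F L N | t.e = E₀ ∧ t.d = D₀} := by
  have hLN : L ≤ N := by lia
  have hA := two_le_card_pow (F := F) hL
  have hB := two_mul_card_pow_le (F := F) hN
  have h := card_san_le_of_notMem_range hLN E₀ D₀ hc x
  have hB1 : 1 ≤ Fintype.card F ^ (N - L) := Nat.one_le_pow _ _ Fintype.card_pos
  replace h := (Nat.cast_le (α := ℝ)).2 h
  push_cast [Nat.cast_sub hB1] at h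
  rw [cast_card_NZ hLN, leak]
  generalize (Fintype.card F : ℝ) ^ L = A at *
  generalize (Fintype.card F : ℝ) ^ (N - L) = B at *
  generalize (#{t : KeyTriple F L N | t.e = E₀ ∧ t.d = D₀} : ℝ) = n at *
  have hr : (0 : ℝ) ≤ #{t : KeyTriple F L N | (t.e = E₀ ∧ t.d = D₀) ∧
    mulNZ le_rfl t.r c = x} := by positivity
  generalize (#{t : KeyTriple F L N | (t.e = E₀ ∧ t.d = D₀) ∧
    mulNZ le_rfl t.r c = x} : ℝ) = r at *
  have hB0 : 0 < B := by linarith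
  have key : A * B - 1 ≤ (1 + A / B) * (A * (B - 1)) := by
    rw [← sub_nonneg]
    have : (1 + A / B) * (A * (B - 1)) - (A * B - 1) =
        (A ^ 2 * (B - 1) - (A - 1) * B) / B := by
      field_simp; ring
    rw [this]
    refine div_nonneg ?_ hB0.le
    nlinarith [mul_nonneg (by linarith : 0 ≤ A - 2) (by linarith : 0 ≤ B - 2 * A),
      mul_nonneg (mul_nonneg (by linarith : 0 ≤ A - 1) (by linarith : 0 ≤ A - 1)) hB0.le]
  calc (A * B - 1) * r ≤ (1 + A / B) * (A * (B - 1)) * r := mul_le_mul_of_nonneg_right key hr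
    _ = (1 + A / B) * (r * (A * (B - 1))) := by ring
    _ ≤ (1 + A / B) * n := mul_le_mul_of_nonneg_left h (by positivity)

theorem card_san_le_div (hLN : L ≤ N) (E₀ : FR F N L) (D₀ : FR F L N) {c : NZ F N}
    {m : Fin L → F} (hc : E₀.1.mulVec m = c.1) (x : NZ F N) :
    (#{t : KeyTriple F L N | (t.e = E₀ ∧ t.d = D₀) ∧ mulNZ le_rfl t.r c = x} : ℝ) ≤
      #{t : KeyTriple F L N | t.e = E₀ ∧ t.d = D₀} / (Fintype.card F : ℝ) ^ (N - L) := by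
  have : (0 : ℝ) < (Fintype.card F : ℝ) ^ (N - L) := by
    have := Fintype.card_pos (α := F)
    positivity
  rw [le_div_iff₀ this]
  exact_mod_cast card_san_le_of_mem_range hLN E₀ D₀ hc x

/-- Collision bound for two decryption matrices and a common encryption matrix. -/
theorem sum_collisions_le (hL : 1 ≤ L) (hN : 2 * L < N) (E₀ : FR F N L) (D D' : FR F L N)
    (c c' : NZ F N) :
    (Fintype.card (NZ F N) : ℝ) * ∑ t : KeyTriple F L N with t.e = E₀ ∧ t.d = D,
      (#{s : KeyTriple F L N | (s.e = E₀ ∧ s.d = D') ∧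
        mulNZ le_rfl s.r c' = mulNZ le_rfl t.r c} : ℝ) ≤
    #{t : KeyTriple F L N | t.e = E₀ ∧ t.d = D} * #{t : KeyTriple F L N | t.e = E₀ ∧ t.d = D'} *
      (Fintype.card (NZ F N) / ((Fintype.card F : ℝ) ^ (N - L)) ^ 2 * kerInter D D' +
        2 * leak F L N) := by
  have hLN : L ≤ N := by lia
  by_cases hne : ∃ t : KeyTriple F L N, t.e = E₀ ∧ t.d = D
  swap
  · rw [filter_eq_empty_iff.2 fun t _ ht => hne ⟨t, ht⟩]
    simp
  have hsum : ∀ (D : FR F L N) (c : NZ F N),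
      (#{t : KeyTriple F L N | t.e = E₀ ∧ t.d = D} : ℝ) = ∑ x : NZ F N,
        (#{t : KeyTriple F L N | (t.e = E₀ ∧ t.d = D) ∧ mulNZ le_rfl t.r c = x} : ℝ) := by
    intro D c
    rw [← Nat.cast_sum, card_eq_sum_card_fiberwise
      (f := fun t : KeyTriple F L N => mulNZ le_rfl t.r c) (t := univ) (fun _ _ => by simp)]
    simp only [filter_filter]
  have hcol : ∑ t : KeyTriple F L N with t.e = E₀ ∧ t.d = D,
      (#{s : KeyTriple F L N | (s.e = E₀ ∧ s.d = D') ∧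
        mulNZ le_rfl s.r c' = mulNZ le_rfl t.r c} : ℝ) = ∑ x : NZ F N,
      (#{t : KeyTriple F L N | (t.e = E₀ ∧ t.d = D) ∧ mulNZ le_rfl t.r c = x} : ℝ) *
      #{t : KeyTriple F L N | (t.e = E₀ ∧ t.d = D') ∧ mulNZ le_rfl t.r c' = x} := by
    rw [← sum_fiberwise_of_maps_to (t := univ)
      (g := fun t : KeyTriple F L N => mulNZ le_rfl t.r c) (fun _ _ => mem_univ _)]
    refine sum_congr rfl fun x _ => ?_
    rw [filter_filter, ← nsmul_eq_mul, ← sum_const]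
    refine sum_congr rfl fun t ht => ?_
    rw [(mem_filter.1 ht).2.2]
  have hA := two_le_card_pow (F := F) hL
  have hB := two_mul_card_pow_le (F := F) hN
  have hX := cast_card_NZ (F := F) hLN
  -- As `ker D ∩ ker D'` has dimension at least `N - 2L`, the bound `1 + leak` for ciphertexts
  -- outside of the column space is contained in the claimed one.
  have hS : 1 + leak F L N ≤ Fintype.card (NZ F N) / ((Fintype.card F : ℝ) ^ (N - L)) ^ 2 *
      kerInter D D' + 2 * leak F L N := by
    obtain ⟨t, -, rfl⟩ := hne
    have hK := (Nat.cast_le (α := ℝ)).2 (card_pow_le_kerInter hLN t D')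
    push_cast at hK
    rw [hX, leak]
    generalize (Fintype.card F : ℝ) ^ L = A at *
    generalize (Fintype.card F : ℝ) ^ (N - L) = B at *
    generalize (kerInter t.d D' : ℝ) = K at *
    have hK' : B / A ≤ K := by rwa [div_le_iff₀ (by linarith)]
    have hAB : 0 ≤ A * B - 1 := by nlinarith
    have hA0 : 0 < A := by linarith
    have hB0 : 0 < B := by linarith
    have h1 : (A * B - 1) / B ^ 2 * (B / A) ≤ (A * B - 1) / B ^ 2 * K := by gcongr
    have h2 : (A * B - 1) / B ^ 2 * (B / A) = 1 - 1 / (A * B) := by field_simp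
    have h3 : 1 / (A * B) ≤ A / B := by
      rw [div_le_div_iff₀ (by positivity) hB0]
      nlinarith [mul_pos hA0 hB0]
    linarith
  rw [hcol, mul_sum]
  by_cases hc : ∃ m, E₀.1.mulVec m = c.1
  · by_cases hc' : ∃ m, E₀.1.mulVec m = c'.1
    · obtain ⟨m, hm⟩ := hc
      obtain ⟨m', hm'⟩ := hc'
      -- Both sanitized ciphertexts are uniform on fibres, and the fibres meet in few vectors.
      have hzero : ∀ (D : FR F L N) (c : NZ F N) (m : Fin L → F), E₀.1.mulVec m = c.1 →
          ∀ x : NZ F N, D.1.mulVec x.1 ≠ m →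
          #{t : KeyTriple F L N | (t.e = E₀ ∧ t.d = D) ∧ mulNZ le_rfl t.r c = x} = 0 := by
        intro D c m hm x hx
        rw [card_eq_zero, filter_eq_empty_iff]
        rintro t - ⟨⟨rfl, rfl⟩, rfl⟩
        exact hx (by simp only [mulNZ]; rw [← hm, t.d_r_e_mulVec])
      set n := (#{t : KeyTriple F L N | t.e = E₀ ∧ t.d = D} : ℝ)
      set n' := (#{t : KeyTriple F L N | t.e = E₀ ∧ t.d = D'} : ℝ)
      set B := (Fintype.card F : ℝ) ^ (N - L)
      have hB0 : 0 < B := by linarith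
      have hterm : ∀ x : NZ F N, (Fintype.card (NZ F N) : ℝ) *
          ((#{t : KeyTriple F L N | (t.e = E₀ ∧ t.d = D) ∧ mulNZ le_rfl t.r c = x} : ℝ) *
          #{t : KeyTriple F L N | (t.e = E₀ ∧ t.d = D') ∧ mulNZ le_rfl t.r c' = x}) ≤
          if D.1.mulVec x.1 = m ∧ D'.1.mulVec x.1 = m' then
            Fintype.card (NZ F N) * (n / B * (n' / B)) else 0 := by
        intro x
        split_ifs with h
        · have := card_san_le_div hLN E₀ D hm x
          have := card_san_le_div hLN E₀ D' hm' x
          gcongr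
        · rcases not_and_or.1 h with h | h
          · rw [hzero D c m hm x h]; simp
          · rw [hzero D' c' m' hm' x h]; simp
      refine (sum_le_sum fun x _ => hterm x).trans ?_
      rw [← sum_filter, sum_const, nsmul_eq_mul]
      have hcard : #{x : NZ F N | D.1.mulVec x.1 = m ∧ D'.1.mulVec x.1 = m'} ≤
          kerInter D D' := by
        refine le_trans ?_ (card_inter_fiber_le D D' m m')
        refine card_le_card_of_injOn Subtype.val (fun x hx => ?_) Subtype.val_injective.injOn
        simpa using hx
      have hleak : 0 ≤ leak F L N := by unfold leak; positivity
      calc _ ≤ (kerInter D D' : ℝ) * (Fintype.card (NZ F N) * (n / B * (n' / B))) := by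
            gcongr
        _ = n * n' * (Fintype.card (NZ F N) / B ^ 2 * kerInter D D') := by field_simp
        _ ≤ _ := mul_le_mul_of_nonneg_left (by linarith) (by positivity)
    · rw [mul_assoc, hsum D c, sum_mul]
      refine sum_le_sum fun x _ => ?_
      rw [mul_left_comm]
      refine mul_le_mul_of_nonneg_left ?_ (by positivity)
      refine (card_NZ_mul_card_san_le hL hN E₀ D' (not_exists.1 hc') x).trans ?_
      rw [mul_comm]
      exact mul_le_mul_of_nonneg_left hS (by positivity)
  · rw [mul_right_comm, hsum D' c', mul_sum]
    refine sum_le_sum fun x _ => ?_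
    rw [← mul_assoc]
    refine mul_le_mul_of_nonneg_right ?_ (by positivity)
    refine (card_NZ_mul_card_san_le hL hN E₀ D (not_exists.1 hc) x).trans ?_
    rw [mul_comm]
    exact mul_le_mul_of_nonneg_left hS (by positivity)

/-- Collision bound for a hidden view that consists of the decryption matrix and a public output
that contains both matrices. -/
theorem sum_collisions_div_le (hL : 1 ≤ L) (hN : 2 * L < N) (D : FR F L N) (c c' : NZ F N) :
    ∑ t : KeyTriple F L N with t.d = D, (Fintype.card (NZ F N) : ℝ) *
      (#{s : KeyTriple F L N | (s.e = t.e ∧ s.d = D) ∧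
        mulNZ le_rfl s.r c' = mulNZ le_rfl t.r c} : ℝ) /
          #{s : KeyTriple F L N | s.e = t.e ∧ s.d = D} ≤
    #{t : KeyTriple F L N | t.d = D} * (1 + 2 * leak F L N) := by
  have hLN : L ≤ N := by lia
  have hA := two_le_card_pow (F := F) hL
  have hB := two_mul_card_pow_le (F := F) hN
  have hA1 : 1 ≤ Fintype.card F ^ L := Nat.one_le_pow _ _ Fintype.card_pos
  have hcount := congrArg (Nat.cast : ℕ → ℝ) (card_d_eq_and_mem_range_e hLN D c')
  push_cast [Nat.cast_sub hA1] at hcount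
  have hterm : ∀ t ∈ ({t | t.d = D} : Finset (KeyTriple F L N)),
      (Fintype.card (NZ F N) : ℝ) *
      (#{s : KeyTriple F L N | (s.e = t.e ∧ s.d = D) ∧
        mulNZ le_rfl s.r c' = mulNZ le_rfl t.r c} : ℝ) /
          #{s : KeyTriple F L N | s.e = t.e ∧ s.d = D} ≤ (1 + leak F L N) +
        if ∃ m, t.e.1.mulVec m = c'.1 then
          (Fintype.card (NZ F N) : ℝ) / (Fintype.card F : ℝ) ^ (N - L) else 0 := by
    intro t ht
    have hn : (0 : ℝ) < #{s : KeyTriple F L N | s.e = t.e ∧ s.d = D} := by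
      rw [Nat.cast_pos, card_pos]
      exact ⟨t, by simpa using ht⟩
    have hleak : 0 ≤ leak F L N := by unfold leak; positivity
    split_ifs with h
    · obtain ⟨m, hm⟩ := h
      refine le_add_of_nonneg_of_le (by positivity) ?_
      rw [div_le_iff₀ hn, div_mul_eq_mul_div, mul_div_assoc]
      exact mul_le_mul_of_nonneg_left (card_san_le_div hLN t.e D hm _) (by positivity)
    · rw [add_zero, div_le_iff₀ hn]
      exact card_NZ_mul_card_san_le hL hN t.e D (not_exists.1 h) _
  refine (sum_le_sum hterm).trans ?_
  rw [sum_add_distrib, sum_const, nsmul_eq_mul, ← sum_filter, filter_filter, sum_const,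
    nsmul_eq_mul, mul_div_assoc', mul_comm _ (Fintype.card (NZ F N) : ℝ), hcount, leak]
  have hn : (0 : ℝ) ≤ #{s : KeyTriple F L N | s.d = D} := by positivity
  generalize (#{s : KeyTriple F L N | s.d = D} : ℝ) = n at *
  generalize (Fintype.card F : ℝ) ^ L = A at *
  generalize (Fintype.card F : ℝ) ^ (N - L) = B at *
  have hB0 : 0 < B := by linarith
  have : (A - 1) * n / B ≤ n * (A / B) := by
    rw [mul_div_assoc', mul_comm n]
    gcongr
    linarith
  linarith

end KeyTriple

/-! ### The chi-square bound -/

/-- Chi-square bound for an adaptive adversary against a product. In the `i`-th coordinate, a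
hidden view `a i` occurs jointly with the public output `z i` with weight `w i (a i) (c i) (z i)`,
where the tuple `c` is chosen by the adversary at random (with probabilities `att a c`) as a
function of the whole tuple `a` of hidden views. The number `M i a a'` bounds the collision of two
hidden views whatever the adversary chooses; as the bound does not depend on the choices, it
tensorizes although the choices are correlated between the coordinates. -/
theorem sq_sum_abs_sub_le {I A C Z : Type*} [Fintype I] [Fintype A] [Fintype C] [Fintype Z]
    (w : I → A → C → Z → ℝ) (hw : ∀ i a c z, 0 ≤ w i a c z)
    (Q : I → Z → ℝ) (hQ : ∀ i z, 0 ≤ Q i z) (hQ1 : ∀ i, ∑ z, Q i z = 1)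
    (hac : ∀ i a c z, Q i z = 0 → w i a c z = 0)
    (att : (I → A) → (I → C) → ℝ) (hatt : ∀ a c, 0 ≤ att a c) (hatt1 : ∀ a, ∑ c, att a c = 1)
    (P : (I → Z) → ℝ) (hP : ∀ z, P z = ∑ a, ∑ c, att a c * ∏ i, w i (a i) (c i) (z i))
    (hP1 : ∑ z, P z = 1) (M : I → A → A → ℝ)
    (hM : ∀ i a a' c c', ∑ z, w i a c z * w i a' c' z / Q i z ≤ M i a a') :
    (∑ z, |P z - ∏ i, Q i (z i)|) ^ 2 ≤ ∏ i, ∑ a, ∑ a', M i a a' - 1 := by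
  set f : (I → Z) → ℝ := fun z => ∏ i, Q i (z i) with hf
  have hf0 : ∀ z, 0 ≤ f z := fun z => prod_nonneg fun i _ => hQ i _
  have hf1 : ∑ z, f z = 1 := by
    simp only [hf]
    rw [← Fintype.prod_sum]
    simp [hQ1]
  have hPf : ∀ z, f z = 0 → P z = 0 := by
    intro z hz
    obtain ⟨i, -, hi⟩ := prod_eq_zero_iff.1 hz
    rw [hP]
    refine sum_eq_zero fun a _ => sum_eq_zero fun c _ => ?_
    rw [prod_eq_zero (mem_univ i) (hac i _ _ _ hi), mul_zero]
  have hCS : (∑ z, |P z - f z|) ^ 2 ≤ (∑ z, f z) * ∑ z, (P z - f z) ^ 2 / f z := by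
    refine sum_sq_le_sum_mul_sum_of_sq_le_mul _ (fun z _ => hf0 z)
      (fun z _ => div_nonneg (sq_nonneg _) (hf0 z)) fun z _ => ?_
    rw [sq_abs]
    by_cases hz : f z = 0
    · simp [hz, hPf z hz]
    · rw [mul_div_cancel₀ _ hz]
  have hexp : ∑ z, (P z - f z) ^ 2 / f z = ∑ z, P z ^ 2 / f z - 1 := by
    have : ∀ z, (P z - f z) ^ 2 / f z = P z ^ 2 / f z - 2 * P z + f z := by
      intro z
      by_cases hz : f z = 0
      · simp [hz, hPf z hz]
      · field_simp
        ring
    simp only [this, sum_add_distrib, sum_sub_distrib, ← mul_sum, hP1, hf1]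
    ring
  have hsq : ∀ z, P z ^ 2 / f z = ∑ a, ∑ a', ∑ c, ∑ c', att a c * att a' c' *
      ∏ i, (w i (a i) (c i) (z i) * w i (a' i) (c' i) (z i) / Q i (z i)) := by
    intro z
    rw [sq, hP, sum_mul_sum, sum_div]
    refine sum_congr rfl fun a _ => ?_
    rw [sum_div]
    refine sum_congr rfl fun a' _ => ?_
    rw [sum_mul_sum, sum_div]
    refine sum_congr rfl fun c _ => ?_
    rw [sum_div]
    refine sum_congr rfl fun c' _ => ?_
    rw [prod_div_distrib, prod_mul_distrib]
    ring
  have hbound : ∑ z, P z ^ 2 / f z ≤ ∏ i, ∑ a, ∑ a', M i a a' := by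
    have hswap : ∑ z, P z ^ 2 / f z = ∑ a, ∑ a', ∑ c, ∑ c', att a c * att a' c' *
        ∏ i, ∑ y, (w i (a i) (c i) y * w i (a' i) (c' i) y / Q i y) := by
      simp only [hsq]
      rw [sum_comm]
      refine sum_congr rfl fun a _ => ?_
      rw [sum_comm]
      refine sum_congr rfl fun a' _ => ?_
      rw [sum_comm]
      refine sum_congr rfl fun c _ => ?_
      rw [sum_comm]
      refine sum_congr rfl fun c' _ => ?_
      rw [← mul_sum, Fintype.prod_sum fun i y =>
        w i (a i) (c i) y * w i (a' i) (c' i) y / Q i y]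
    have hM' : ∏ i, ∑ a, ∑ a', M i a a' = ∑ a : I → A, ∑ a' : I → A, ∏ i, M i (a i) (a' i) := by
      rw [Fintype.prod_sum]
      exact sum_congr rfl fun a _ => Fintype.prod_sum _
    rw [hswap, hM']
    refine sum_le_sum fun a _ => sum_le_sum fun a' _ => ?_
    calc _ ≤ ∑ c, ∑ c', att a c * att a' c' * ∏ i, M i (a i) (a' i) := by
          refine sum_le_sum fun c _ => sum_le_sum fun c' _ =>
            mul_le_mul_of_nonneg_left ?_ (mul_nonneg (hatt _ _) (hatt _ _))
          exact prod_le_prod (fun i _ => sum_nonneg fun z _ =>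
            div_nonneg (mul_nonneg (hw _ _ _ _) (hw _ _ _ _)) (hQ _ _)) fun i _ => hM _ _ _ _ _
      _ = (∑ c, att a c) * (∑ c', att a' c') * ∏ i, M i (a i) (a' i) := by
          rw [sum_mul_sum, sum_mul]
          exact sum_congr rfl fun c _ => by rw [sum_mul]
      _ = ∏ i, M i (a i) (a' i) := by rw [hatt1, hatt1, one_mul, one_mul]
  rw [hf1, one_mul, hexp] at hCS
  linarith

/-- The collision sum of `sq_sum_abs_sub_le`, when a uniform secret `t` determines the hidden view
`α t` and the public output `(ρ t c, β t)`, and the reference distribution is uniform in the first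
component. -/
theorem sum_collision_eq {T A B C X : Type*} [Fintype T] [Fintype B] [Fintype X] [Nonempty T]
    [Nonempty X] (α : T → A) (β : T → B) (ρ : T → C → X) (a a' : A) (c c' : C) :
    ∑ z : X × B, ((#{t | α t = a ∧ (ρ t c, β t) = z} : ℝ) / Fintype.card T) *
      ((#{t | α t = a' ∧ (ρ t c', β t) = z} : ℝ) / Fintype.card T) /
        ((#{t | β t = z.2} : ℝ) / (Fintype.card T * Fintype.card X)) =
    (∑ t with α t = a, (Fintype.card X : ℝ) *
      #{s | (α s = a' ∧ β s = β t) ∧ ρ s c' = ρ t c} / #{s | β s = β t}) / Fintype.card T := by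
  have hT : (Fintype.card T : ℝ) ≠ 0 := by positivity
  have hX : (Fintype.card X : ℝ) ≠ 0 := by positivity
  have h1 : ∀ z : X × B, (#{t | α t = a ∧ (ρ t c, β t) = z} : ℝ) =
      ∑ t with α t = a, if (ρ t c, β t) = z then 1 else 0 := by
    intro z
    rw [← sum_filter, filter_filter]
    simp
  have h2 : ∀ z : X × B, ((#{t | α t = a ∧ (ρ t c, β t) = z} : ℝ) / Fintype.card T) *
      ((#{t | α t = a' ∧ (ρ t c', β t) = z} : ℝ) / Fintype.card T) /
        ((#{t | β t = z.2} : ℝ) / (Fintype.card T * Fintype.card X)) =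
      ∑ t with α t = a, if (ρ t c, β t) = z then
        (Fintype.card X : ℝ) * #{s | α s = a' ∧ (ρ s c', β s) = z} / #{s | β s = z.2} /
          Fintype.card T else 0 := by
    intro z
    rw [h1, sum_div, sum_mul, sum_div]
    refine sum_congr rfl fun t _ => ?_
    split_ifs
    · by_cases h : (#{s | β s = z.2} : ℝ) = 0
      · simp [h]
      · field_simp
    · simp
  simp only [h2]
  rw [sum_comm, sum_div]
  refine sum_congr rfl fun t _ => ?_
  rw [sum_ite_eq, if_pos (mem_univ _)]
  have h3 : univ.filter (fun s => α s = a' ∧ (ρ s c', β s) = (ρ t c, β t)) =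
      univ.filter fun s => (α s = a' ∧ β s = β t) ∧ ρ s c' = ρ t c := by
    ext s
    simp only [mem_filter, mem_univ, true_and, Prod.mk.injEq]
    tauto
  rw [h3]

/-! ### Collision sums of a single edge -/

namespace KeyTriple

/-- An edge that leaves a corrupt sender: the sender's side knows both matrices, the receiver's side
knows the encryption matrix. -/
theorem exists_collision_bound_of_sender {A B : Type*} [Fintype A] [Fintype B]
    (hL : 1 ≤ L) (hN : 2 * L < N) (α : KeyTriple F L N → A) (β : KeyTriple F L N → B)
    (hα : ∀ s t, α s = α t ↔ s.e = t.e ∧ s.d = t.d) (hβ : ∀ s t, β s = β t ↔ s.e = t.e) :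
    ∃ M : A → A → ℝ, (∀ a a' (c c' : NZ F N),
      (∑ t with α t = a, (Fintype.card (NZ F N) : ℝ) *
        #{s | (α s = a' ∧ β s = β t) ∧ mulNZ le_rfl s.r c' = mulNZ le_rfl t.r c} /
          #{s | β s = β t}) / Fintype.card (KeyTriple F L N) ≤ M a a') ∧
      ∑ a, ∑ a', M a a' ≤ 1 + 3 * leak F L N := by
  have hLN : L ≤ N := by lia
  have : Nonempty (KeyTriple F L N) := nonempty_keyTriple hLN
  have hT : (0 : ℝ) < Fintype.card (KeyTriple F L N) := by
    exact_mod_cast Fintype.card_pos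
  set S : FR F L N → FR F L N → ℝ := fun D D' =>
    Fintype.card (NZ F N) / ((Fintype.card F : ℝ) ^ (N - L)) ^ 2 * kerInter D D' +
      2 * leak F L N with hS
  -- The bound `M a a'` is an average over pairs of triples with views `a`, `a'` and the same `E`;
  -- summed over all `a'`, it becomes the mean of `S` over the decryption matrices for this `E`.
  refine ⟨fun a a' => (∑ t with α t = a, (∑ s with s.e = t.e ∧ α s = a', S t.d s.d) /
    #{s : KeyTriple F L N | s.e = t.e}) / Fintype.card (KeyTriple F L N), ?_, ?_⟩
  · intro a a' c c'
    simp only [hβ]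
    refine div_le_div_of_nonneg_right ?_ hT.le
    by_cases ht : ∃ t, α t = a
    swap
    · rw [filter_eq_empty_iff.2 fun t _ h => ht ⟨t, h⟩]
      simp
    obtain ⟨t₀, rfl⟩ := ht
    simp only [hα]
    by_cases hs : ∃ s, s.e = t₀.e ∧ α s = a'
    swap
    · refine sum_le_sum fun t ht => ?_
      have ht' := (mem_filter.1 ht).2.1
      rw [ht', filter_eq_empty_iff.2 fun s _ h => hs ⟨s, h.1.2, h.1.1⟩,
        filter_eq_empty_iff.2 fun s _ h => hs ⟨s, h⟩]
      simp
    obtain ⟨s₀, hs₀, rfl⟩ := hs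
    simp only [hα]
    have key := sum_collisions_le hL hN t₀.e t₀.d s₀.d c c'
    set n : ℝ := (#{s : KeyTriple F L N | s.e = t₀.e} : ℝ)
    calc _ = ((Fintype.card (NZ F N) : ℝ) * ∑ t : KeyTriple F L N with t.e = t₀.e ∧ t.d = t₀.d,
          (#{s : KeyTriple F L N | (s.e = t₀.e ∧ s.d = s₀.d) ∧
            mulNZ le_rfl s.r c' = mulNZ le_rfl t.r c} : ℝ)) / n := by
          rw [mul_sum, sum_div]
          refine sum_congr rfl fun t ht => ?_
          rw [(mem_filter.1 ht).2.1, hs₀]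
          congr 4
          ext s
          simp only [mem_filter, mem_univ, true_and]
          tauto
      _ ≤ _ := div_le_div_of_nonneg_right key (by positivity)
      _ = _ := by
          rw [mul_assoc, ← nsmul_eq_mul, ← sum_const, sum_div]
          refine sum_congr rfl fun t ht => ?_
          obtain ⟨he, hd⟩ := (mem_filter.1 ht).2
          rw [he, hd, hs₀, ← nsmul_eq_mul, ← sum_const]
          congr 1
          refine sum_congr (by ext s; simp only [mem_filter, mem_univ, true_and]; tauto)
            fun s hs => ?_
          have : s.d = s₀.d := by
            have := (mem_filter.1 hs).2
            tauto
          rw [this]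
  · have h1 : ∀ t : KeyTriple F L N, ∑ s : KeyTriple F L N with s.e = t.e, S t.d s.d ≤
        #{s : KeyTriple F L N | s.e = t.e} * (1 + 3 * leak F L N) := by
      intro t
      have hA := two_le_card_pow (F := F) hL
      have hB := two_mul_card_pow_le (F := F) hN
      have hX := cast_card_NZ (F := F) hLN
      have h := t.sum_kerInter hLN
      simp only [hS]
      rw [sum_add_distrib, ← mul_sum, div_mul_eq_mul_div, h, sum_const, nsmul_eq_mul,
        mul_div_assoc, ← mul_add]
      refine mul_le_mul_of_nonneg_left ?_ (by positivity)
      rw [hX, leak]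
      generalize (Fintype.card F : ℝ) ^ L = A at *
      generalize (Fintype.card F : ℝ) ^ (N - L) = B at *
      have hB0 : 0 < B := by linarith
      have : (A * B - 1 + (B - 1) ^ 2) / B ^ 2 ≤ 1 + A / B := by
        have h2 : 1 + A / B = (B ^ 2 + A * B) / B ^ 2 := by field_simp
        rw [h2]
        refine div_le_div_of_nonneg_right ?_ (by positivity)
        nlinarith
      linarith
    have h2 : ∀ t : KeyTriple F L N, ∑ a', (∑ s with s.e = t.e ∧ α s = a', S t.d s.d) /
        (#{s : KeyTriple F L N | s.e = t.e} : ℝ) ≤ 1 + 3 * leak F L N := by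
      intro t
      have hn : (0 : ℝ) < #{s : KeyTriple F L N | s.e = t.e} := by
        rw [Nat.cast_pos, card_pos]
        exact ⟨t, by simp⟩
      rw [← sum_div, div_le_iff₀ hn, mul_comm]
      refine le_of_eq_of_le ?_ (h1 t)
      rw [← sum_fiberwise_of_maps_to (t := univ) (g := α) (fun _ _ => mem_univ _)]
      simp only [filter_filter]
    calc _ = (∑ a, ∑ t : KeyTriple F L N with α t = a, ∑ a',
          (∑ s with s.e = t.e ∧ α s = a', S t.d s.d) /
          (#{s : KeyTriple F L N | s.e = t.e} : ℝ)) / Fintype.card (KeyTriple F L N) := by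
          rw [sum_div]
          refine sum_congr rfl fun a _ => ?_
          rw [← sum_div, sum_comm]
      _ = (∑ t : KeyTriple F L N, ∑ a', (∑ s with s.e = t.e ∧ α s = a', S t.d s.d) /
          (#{s : KeyTriple F L N | s.e = t.e} : ℝ)) / Fintype.card (KeyTriple F L N) := by
          congr 1
          exact sum_fiberwise_of_maps_to (fun _ _ => mem_univ _) _
      _ ≤ 1 + 3 * leak F L N := by
          rw [div_le_iff₀ hT]
          refine (sum_le_sum fun t _ => h2 t).trans ?_
          rw [sum_const, card_univ, nsmul_eq_mul, mul_comm]

/-- An edge that leaves an honest sender: the leaking side knows at most the decryption matrix,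
the listening side may know both matrices. -/
theorem exists_collision_bound_of_not_sender {A B : Type*} [Fintype A] [Fintype B]
    (hL : 1 ≤ L) (hN : 2 * L < N) (α : KeyTriple F L N → A) (β : KeyTriple F L N → B)
    (hα : ∀ s t, α s = α t ↔ s.d = t.d) (hβ : ∀ s t, β s = β t ↔ s.e = t.e ∧ s.d = t.d) :
    ∃ M : A → A → ℝ, (∀ a a' (c c' : NZ F N),
      (∑ t with α t = a, (Fintype.card (NZ F N) : ℝ) *
        #{s | (α s = a' ∧ β s = β t) ∧ mulNZ le_rfl s.r c' = mulNZ le_rfl t.r c} /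
          #{s | β s = β t}) / Fintype.card (KeyTriple F L N) ≤ M a a') ∧
      ∑ a, ∑ a', M a a' ≤ 1 + 3 * leak F L N := by
  have hLN : L ≤ N := by lia
  have : Nonempty (KeyTriple F L N) := nonempty_keyTriple hLN
  have hT : (0 : ℝ) < Fintype.card (KeyTriple F L N) := by
    exact_mod_cast Fintype.card_pos
  have hleak : 0 ≤ leak F L N := by unfold leak; positivity
  -- The listener knows `D`, so only equal views of the leaker collide.
  refine ⟨fun a a' => if a = a' then #{t | α t = a} * (1 + 2 * leak F L N) /
    Fintype.card (KeyTriple F L N) else 0, ?_, ?_⟩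
  · intro a a' c c'
    beta_reduce
    split_ifs with haa
    · subst haa
      refine div_le_div_of_nonneg_right ?_ hT.le
      by_cases ht : ∃ t, α t = a
      swap
      · rw [filter_eq_empty_iff.2 fun t _ h => ht ⟨t, h⟩]
        simp
      obtain ⟨t₀, rfl⟩ := ht
      simp only [hα, hβ]
      refine le_of_eq_of_le (sum_congr rfl fun t ht => ?_)
        (sum_collisions_div_le hL hN t₀.d c c')
      have htd : t.d = t₀.d := (mem_filter.1 ht).2
      rw [htd]
      congr 4
      ext s
      simp only [mem_filter, mem_univ, true_and]
      tauto
    · rw [sum_eq_zero, zero_div]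
      intro t ht
      rw [filter_eq_empty_iff.2]
      · simp
      · rintro s - ⟨⟨h1, h2⟩, -⟩
        have h3 : α s = α t := (hα s t).2 ((hβ s t).1 h2).2
        exact haa (by rw [← h1, h3]; exact (mem_filter.1 ht).2.symm)
  · simp only [sum_ite_eq, mem_univ, if_true]
    rw [← sum_div, ← sum_mul, ← Nat.cast_sum,
      ← card_eq_sum_card_fiberwise (f := α) (s := univ) (t := univ) (fun _ _ => by simp),
      card_univ, mul_div_cancel_left₀ _ hT.ne']
    linarith

end KeyTriple

/-! ### Finite probability distributions -/

theorem sum_toReal_eq_one {α : Type*} [Fintype α] (p : PMF α) : ∑ x, (p x).toReal = 1 := by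
  rw [← ENNReal.toReal_sum fun x _ => p.apply_ne_top x, ← tsum_fintype (L := .unconditional _),
    p.tsum_coe, ENNReal.toReal_one]

theorem toReal_bind_apply {α β : Type*} [Fintype α] (p : PMF α) (f : α → PMF β) (y : β) :
    (p.bind f y).toReal = ∑ x, (p x).toReal * (f x y).toReal := by
  rw [PMF.bind_apply, tsum_fintype, ENNReal.toReal_sum fun x _ =>
    ENNReal.mul_ne_top (p.apply_ne_top x) ((f x).apply_ne_top y)]
  simp only [ENNReal.toReal_mul]

theorem toReal_map_apply {α β : Type*} [Fintype α] (p : PMF α) (f : α → β) (y : β) :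
    (p.map f y).toReal = ∑ x, if f x = y then (p x).toReal else 0 := by
  rw [← PMF.bind_pure_comp, toReal_bind_apply]
  refine sum_congr rfl fun x _ => ?_
  simp only [Function.comp_apply, PMF.pure_apply, eq_comm (a := y)]
  split_ifs <;> simp

theorem uniformOfFintype_congr {α : Type*} [Nonempty α] (h h' : Fintype α) :
    @PMF.uniformOfFintype α h _ = @PMF.uniformOfFintype α h' _ := by
  rw [Subsingleton.elim h h']

theorem prodPMF_apply {α β : Type*} (p : PMF α) (q : PMF β) (z : α × β) :
    prodPMF p q z = p z.1 * q z.2 := by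
  rw [prodPMF, PMF.bind_apply, tsum_eq_single z.1]
  · congr 1
    rw [PMF.map_apply, tsum_eq_single z.2]
    · simp
    · intro y hy
      exact if_neg fun h => hy (congrArg Prod.snd h).symm
  · intro x hx
    rw [PMF.map_apply, ENNReal.tsum_eq_zero.2, mul_zero]
    intro y
    rw [if_neg]
    rintro rfl
    exact hx rfl

theorem prodPMF_map {α β γ : Type*} (p : PMF α) (q : PMF β) (g : β → γ) :
    prodPMF p (q.map g) = (prodPMF p q).map (Prod.map id g) := by
  simp only [prodPMF, PMF.map_bind, PMF.map_comp]
  rfl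

/-- If the joint law does not depend on the first component, the conditional law of the first
component is uniform. -/
theorem condLaw_eq_uniformOfFintype {α β : Type*} [Fintype α] [Nonempty α] (p : PMF (α × β))
    (y : β) (hy : y ∈ (p.map Prod.snd).support) (h : ∀ x x', p (x, y) = p (x', y)) :
    condLaw p y hy = PMF.uniformOfFintype α := by
  obtain ⟨r, hr⟩ : ∃ r, ∀ x, condLaw p y hy x = r * p (x, y) := by
    refine ⟨(∑' z, Set.indicator {z : α × β | z.2 = y} p z)⁻¹, fun x => ?_⟩
    rw [condLaw, PMF.map_apply, tsum_eq_single (x, y)]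
    · simp [PMF.filter_apply, mul_comm]
    · rintro ⟨u, v⟩ huv
      split_ifs with hu
      · have hv : v ≠ y := by
          rintro rfl
          exact huv (by rw [hu])
        simp [PMF.filter_apply, hv]
      · rfl
  ext x
  rw [PMF.uniformOfFintype_apply]
  refine ENNReal.eq_inv_of_mul_eq_one_left ?_
  have hsum := (condLaw p y hy).tsum_coe
  rw [tsum_fintype, sum_congr rfl fun x' _ => ((hr x').trans (by rw [h x' x])).trans (hr x).symm,
    sum_const, card_univ, nsmul_eq_mul] at hsum
  rw [mul_comm, hsum]

theorem bind_pure_eq_pure {α β : Type*} (p : PMF α) (f : α → β) (y : β)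
    (h : ∀ x ∈ p.support, f x = y) : (p.bind fun x => PMF.pure (f x)) = PMF.pure y := by
  rw [← PMF.bind_const p (PMF.pure y)]
  ext z
  rw [PMF.bind_apply, PMF.bind_apply]
  refine tsum_congr fun x => ?_
  by_cases hx : x ∈ p.support
  · rw [h x hx]
  · rw [(PMF.apply_eq_zero_iff _ _).2 hx, zero_mul, zero_mul]

theorem SD_eq_sum {α : Type*} [Fintype α] (p q : PMF α) :
    SD p q = 1 / 2 * ∑ x, |(p x).toReal - (q x).toReal| := by
  rw [SD, tsum_fintype]

/-- Data processing: the statistical distance does not increase under a map. -/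
theorem SD_map_le {α β : Type*} [Finite α] [Finite β] (p q : PMF α) (f : α → β) :
    SD (p.map f) (q.map f) ≤ SD p q := by
  have := Fintype.ofFinite α
  have := Fintype.ofFinite β
  rw [SD_eq_sum, SD_eq_sum]
  refine mul_le_mul_of_nonneg_left ?_ (by norm_num)
  calc _ ≤ ∑ y, ∑ x with f x = y, |(p x).toReal - (q x).toReal| := by
        refine sum_le_sum fun y _ => ?_
        rw [toReal_map_apply, toReal_map_apply, ← sum_filter, ← sum_filter, ← sum_sub_distrib]
        exact abs_sum_le_sum_abs _ _
    _ = _ := sum_fiberwise_of_maps_to (fun _ _ => mem_univ _) _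

theorem sum_abs_sub_le_two {α : Type*} [Fintype α] (p q : PMF α) :
    ∑ x, |(p x).toReal - (q x).toReal| ≤ 2 := by
  calc _ ≤ ∑ x, ((p x).toReal + (q x).toReal) := by
        refine sum_le_sum fun x _ => (abs_sub _ _).trans ?_
        rw [abs_of_nonneg ENNReal.toReal_nonneg, abs_of_nonneg ENNReal.toReal_nonneg]
    _ = 2 := by rw [sum_add_distrib, sum_toReal_eq_one, sum_toReal_eq_one]; norm_num

theorem indepPMF_apply {ι : Type*} [Fintype ι] {α : ι → Type*} [∀ i, Finite (α i)]
    (p : ∀ i, PMF (α i)) (x : ∀ i, α i) : indepPMF p x = ∏ i, p i (x i) := rfl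

/-! ### Attacks on independent uniform secrets -/

section Channel

variable {I T A B C X : Type*} [Fintype I] [Fintype X]

/-- The joint law of the outputs `ρ (k i) (c i)` and the public views `β i (k i)`, when the inputs
`c` are chosen as a function of the hidden views `α i (k i)` of the secrets `k`. -/
def attackLaw (keys : PMF (I → T)) (α : I → T → A) (β : I → T → B) (ρ : T → C → X)
    (att : (I → A) → PMF (I → C)) : PMF (I → X × B) :=
  keys.bind fun k => (att fun i => α i (k i)).map fun c i => (ρ (k i) (c i), β i (k i))

/-- The law that `attackLaw` is compared with: uniform outputs, independent of the public views. -/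
def idealLaw [Nonempty X] (keys : PMF (I → T)) (β : I → T → B) : PMF (I → X × B) :=
  (prodPMF (PMF.uniformOfFintype (I → X)) keys).map fun z i => (z.1 i, β i (z.2 i))

theorem idealLaw_map [Nonempty X] {K : Type*} (keys : PMF (I → T)) (β : I → T → B)
    (f : (I → B) → K) :
    (idealLaw keys β).map (fun z : I → X × B => ((fun i => (z i).1), f fun i => (z i).2)) =
      prodPMF (PMF.uniformOfFintype (I → X)) (keys.map fun k => f fun i => β i (k i)) := by
  rw [prodPMF_map, idealLaw, PMF.map_comp]
  rfl

/-- The chi-square bound for `attackLaw`, given for each coordinate a bound `M` on the collisions of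
two hidden views. -/
theorem sq_sum_abs_attackLaw_sub_idealLaw_le [Fintype T] [Nonempty T] [Nonempty X]
    [Fintype A] [Fintype B] [Finite C]
    (keys : PMF (I → T)) (hkeys : ∀ k, (keys k).toReal = ∏ _i : I, (1 / Fintype.card T : ℝ))
    (α : I → T → A) (β : I → T → B) (ρ : T → C → X) (att : (I → A) → PMF (I → C))
    (M : I → A → A → ℝ) (hM : ∀ i a a' c c', (∑ t with α i t = a, (Fintype.card X : ℝ) *
      #{s | (α i s = a' ∧ β i s = β i t) ∧ ρ s c' = ρ t c} / #{s | β i s = β i t}) /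
        Fintype.card T ≤ M i a a') :
    (∑ z, |(attackLaw keys α β ρ att z).toReal - (idealLaw (X := X) keys β z).toReal|) ^ 2 ≤
      ∏ i, ∑ a, ∑ a', M i a a' - 1 := by
  have := Fintype.ofFinite C
  have hT : (0 : ℝ) < Fintype.card T := by exact_mod_cast Fintype.card_pos
  have hX : (0 : ℝ) < Fintype.card X := by exact_mod_cast Fintype.card_pos
  set w : I → A → C → X × B → ℝ := fun i a c z =>
    (#{t | α i t = a ∧ (ρ t c, β i t) = z} : ℝ) / Fintype.card T with hw
  set Q : I → X × B → ℝ := fun i z =>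
    (#{t | β i t = z.2} : ℝ) / (Fintype.card T * Fintype.card X) with hQ
  have hideal : ∀ z, (idealLaw (X := X) keys β z).toReal = ∏ i, Q i (z i) := by
    intro z
    have h1 : ∀ i, Q i (z i) = ∑ t, if β i t = (z i).2 then
        (1 / Fintype.card X : ℝ) * (1 / Fintype.card T) else 0 := by
      intro i
      rw [← sum_filter, sum_const, nsmul_eq_mul]
      simp only [hQ]
      field_simp
    simp only [h1]
    rw [Fintype.prod_sum, idealLaw, toReal_map_apply, Fintype.sum_prod_type, sum_comm]
    refine sum_congr rfl fun k _ => ?_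
    rw [prod_ite_zero, sum_eq_single fun i => (z i).1]
    · simp only [prodPMF_apply, ENNReal.toReal_mul, hkeys, PMF.uniformOfFintype_apply,
        prod_mul_distrib, funext_iff, Prod.ext_iff, true_and, mem_univ, forall_const]
      simp
    · intro x _ hx
      rw [if_neg]
      rintro rfl
      exact hx rfl
    · simp
  have hreal : ∀ z, (attackLaw keys α β ρ att z).toReal =
      ∑ a, ∑ c, (att a c).toReal * ∏ i, w i (a i) (c i) (z i) := by
    intro z
    have h1 : ∀ (a : I → A) (c : I → C) (i : I), w i (a i) (c i) (z i) = ∑ t,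
        if α i t = a i ∧ (ρ t (c i), β i t) = z i then (1 / Fintype.card T : ℝ) else 0 := by
      intro a c i
      rw [← sum_filter, sum_const, nsmul_eq_mul]
      simp only [hw]
      field_simp
    simp only [h1]
    simp only [Fintype.prod_sum, prod_ite_zero, mem_univ, forall_const, mul_sum]
    rw [attackLaw, toReal_bind_apply]
    simp only [toReal_map_apply]
    symm
    calc _ = ∑ k : I → T, ∑ a : I → A, ∑ c : I → C, (att a c).toReal *
          (if ∀ i, α i (k i) = a i ∧ (ρ (k i) (c i), β i (k i)) = z i then
            ∏ _i : I, (1 / Fintype.card T : ℝ) else 0) := by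
          exact (sum_congr rfl fun a _ => sum_comm).trans sum_comm
      _ = _ := by
          refine sum_congr rfl fun k _ => ?_
          rw [sum_eq_single fun i => α i (k i), mul_sum]
          · refine sum_congr rfl fun c _ => ?_
            rw [hkeys]
            simp only [true_and, funext_iff]
            split_ifs <;> ring
          · intro a _ ha
            refine sum_eq_zero fun c _ => ?_
            rw [if_neg, mul_zero]
            intro h
            exact ha (funext fun i => (h i).1.symm)
          · simp
  have hsum : ∀ i, ∑ z, Q i z = 1 := by
    intro i
    rw [Fintype.sum_prod_type]
    simp only [hQ]
    rw [sum_const, ← sum_div, ← Nat.cast_sum, ← card_eq_sum_card_fiberwise (f := β i) (s := univ)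
      (t := univ) (fun _ _ => by simp), card_univ, card_univ, nsmul_eq_mul]
    field_simp
  simp only [hideal]
  refine sq_sum_abs_sub_le w (fun i a c z => by positivity) Q (fun i z => by positivity) hsum
    (fun i a c z hz => ?_) (fun a c => (att a c).toReal) (fun a c => ENNReal.toReal_nonneg)
    (fun a => sum_toReal_eq_one _) _ hreal (sum_toReal_eq_one _) M fun i a a' c c' => ?_
  · have h0 : #{t | β i t = z.2} = 0 := by
      simpa [hQ, hT.ne', hX.ne'] using hz
    have h1 : #{t | α i t = a ∧ (ρ t c, β i t) = z} = 0 := by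
      refine Nat.eq_zero_of_le_zero (h0 ▸ card_le_card fun t ht => ?_)
      have := (mem_filter.1 ht).2.2
      simp [← this]
    simp only [hw, h1, Nat.cast_zero, zero_div]
  · exact (sum_collision_eq (α i) (β i) ρ a a' c c').trans_le (hM i a a' c c')

end Channel

/-! ### From the chi-square bound to the statistical distance -/

/-- The numerical estimate that turns the chi-square bound into a statistical distance: beyond
`2 k t ≥ 1` the trivial bound takes over. -/
theorem half_le_of_sq_le {s t : ℝ} {k : ℕ} (ht : 0 ≤ t) (hs2 : s ≤ 2)
    (hs : s ^ 2 ≤ (1 + 3 * t ^ 2) ^ k - 1) : 1 / 2 * s ≤ 2 * k * t := by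
  rcases Nat.eq_zero_or_pos k with rfl | hk
  · have : s ^ 2 ≤ 0 := by simpa using hs
    have : s = 0 := by nlinarith
    simp [this]
  by_cases h : 1 ≤ 2 * k * t
  · linarith
  have hk1 : (1 : ℝ) ≤ k := by exact_mod_cast hk
  have hkt : (k : ℝ) * t < 1 / 2 := by linarith
  have htk : t ≤ k * t := le_mul_of_one_le_left ht hk1
  have hsq : (k : ℝ) * t ^ 2 ≤ (k * t) ^ 2 := by nlinarith [mul_nonneg ht ht]
  have hlt : ((k : ℝ) * t) ^ 2 < 1 / 4 := by nlinarith
  have hu : 3 * t ^ 2 ≤ 3 / 4 := by nlinarith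
  -- With `u = 3 t²` and `k u ≤ 3 / 4`, Bernoulli's inequality for `(1 - u) ^ k` bounds
  -- `(1 + u) ^ k` by `1 / (1 - k u) ≤ 1 + 4 k u`.
  have hB := one_add_mul_le_pow (a := -(3 * t ^ 2)) (by linarith) k
  have hprod : (1 + 3 * t ^ 2) ^ k * (1 + -(3 * t ^ 2)) ^ k ≤ 1 := by
    rw [← mul_pow]
    exact pow_le_one₀ (by nlinarith [sq_nonneg t]) (by nlinarith [sq_nonneg (t ^ 2)])
  have hpos : (0 : ℝ) ≤ (1 + 3 * t ^ 2) ^ k := by positivity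
  have h1 : (1 + 3 * t ^ 2) ^ k * (1 + k * -(3 * t ^ 2)) ≤ 1 :=
    (mul_le_mul_of_nonneg_left hB hpos).trans hprod
  have h2 : (1 + 3 * t ^ 2) ^ k - 1 ≤ 12 * (k * t ^ 2) := by
    by_contra hcon
    push Not at hcon
    nlinarith [mul_nonneg (by linarith : (0 : ℝ) ≤ k) (sq_nonneg t)]
  have h3 : s ^ 2 ≤ (4 * (k * t)) ^ 2 := by nlinarith
  have := abs_le_of_sq_le_sq' h3 (by positivity)
  linarith [this.2]

/-! ### The random matrix scheme -/

section Scheme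

variable {n : ℕ} {E : Finset (Fin n × Fin n)}

variable (F) in
/-- The law of all key triples of the random matrix scheme. -/
abbrev keysLaw (E : Finset (Fin n × Fin n)) (L N : ℕ) (hLN : L ≤ N) : PMF (E → KeyTriple F L N) :=
  indepPMF fun _ : E => pairKeyGen F L N hLN

/-- The keys of party `i`, computed from all key triples. -/
def partyKey (k : E → KeyTriple F L N) (i : Fin n) :
    ({j : Fin n // (i, j) ∈ E} → FR F N L) × ({j : Fin n // (j, i) ∈ E} → FR F L N) :=
  (fun j => (k ⟨(i, j.1), j.2⟩).e, fun j => (k ⟨(j.1, i), j.2⟩).d)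

theorem keyGen_bind (hN : 2 * L < N) {γ : Type*}
    (f : (randomMatrixScheme F E L N hN).SanKey × (∀ i, (randomMatrixScheme F E L N hN).Key i) →
      PMF γ) :
    (randomMatrixScheme F E L N hN).KeyGen.bind f =
      (keysLaw F E L N (by lia)).bind fun k => f (fun e => (k e).r, partyKey k) :=
  PMF.bind_map _ _ _

theorem keyGen_map (hN : 2 * L < N) {γ : Type*}
    (f : (randomMatrixScheme F E L N hN).SanKey × (∀ i, (randomMatrixScheme F E L N hN).Key i) →
      γ) :
    (randomMatrixScheme F E L N hN).KeyGen.map f =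
      (keysLaw F E L N (by lia)).map fun k => f (fun e => (k e).r, partyKey k) :=
  PMF.map_comp _ _ _

theorem pairKeyGen_apply (hLN : L ≤ N) (t : KeyTriple F L N) :
    pairKeyGen F L N hLN t = (Fintype.card (KeyTriple F L N) : ENNReal)⁻¹ := by
  have : Nonempty (KeyTriple F L N) := nonempty_keyTriple hLN
  exact PMF.uniformOfFintype_apply t

theorem correct (hN : 2 * L < N) : (randomMatrixScheme F E L N hN).Correct := by
  intro a b h m
  rw [keyGen_bind]
  refine (congrArg _ (funext fun k => ?_)).trans (PMF.bind_const _ (PMF.pure m.1))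
  change ((randomMatrixScheme F E L N hN).Enc a b h (partyKey k a) m).bind (fun C =>
    (PMF.pure fun e => mulNZ le_rfl (k e).r (C e)).bind fun C' =>
      PMF.pure ((k ⟨(a, b), h⟩).d.1.mulVec (C' ⟨(a, b), h⟩).1)) = _
  simp only [PMF.pure_bind]
  refine bind_pure_eq_pure _ _ _ fun C hC => ?_
  have hC' : C ⟨(a, b), h⟩ = mulNZ (by lia) (k ⟨(a, b), h⟩).e m := by
    by_contra hne
    refine (PMF.mem_support_iff _ _).1 hC ?_
    refine (indepPMF_apply _ C).trans (prod_eq_zero (mem_univ ⟨(a, b), h⟩) ?_)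
    rw [if_pos rfl]
    exact (PMF.pure_apply_of_ne _ _ hne)
  rw [hC']
  exact (k ⟨(a, b), h⟩).d_r_e_mulVec m.1

/-- The keys other than those of sender and receiver do not see the symmetry `KeyTriple.twist` of
the keys of their edge, which can move any ciphertext to any other one. -/
theorem perfectNoRead (hN : 2 * L < N) : (randomMatrixScheme F E L N hN).PerfectNoRead := by
  intro a b h μ y hy
  have : Nonempty (NZ F N) := nonempty_NZ (by lia)
  refine condLaw_eq_uniformOfFintype _ y hy fun C' C => ?_
  obtain ⟨g, hg, -⟩ := exists_gl_mulVec_eq (L := L) (C ⟨(a, b), h⟩).2 (C' ⟨(a, b), h⟩).2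
  -- `σ` changes only `E` and `D` of the edge `(a, b)`, which nobody but `a` and `b` holds.
  set σ : (E → KeyTriple F L N) ≃ (E → KeyTriple F L N) := Equiv.piCongrRight fun e =>
    if e = ⟨(a, b), h⟩ then KeyTriple.twist g else Equiv.refl _ with hσ
  have hσ1 : ∀ k, σ k ⟨(a, b), h⟩ = KeyTriple.twist g (k ⟨(a, b), h⟩) := fun k => by simp [hσ]
  have hσ2 : ∀ k e, e ≠ ⟨(a, b), h⟩ → σ k e = k e := fun k e he => by simp [hσ, he]
  set other : (E → KeyTriple F L N) → (randomMatrixScheme F E L N hN).OtherKeys a b :=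
    fun k => (fun e => (k e).r, fun i => partyKey k i) with hother
  have hlaw : (randomMatrixScheme F E L N hN).readLaw a b h μ =
      (keysLaw F E L N (by lia)).bind fun k => μ.bind fun m =>
        ((randomMatrixScheme F E L N hN).Enc a b h (partyKey k a) m).map fun C =>
          (C, (other k, m)) := by
    rw [Scheme.readLaw, keyGen_bind]
  have hσr : ∀ k e, (σ k e).r = (k e).r := by
    intro k e
    by_cases he : e = ⟨(a, b), h⟩
    · rw [he, hσ1]; rfl
    · rw [hσ2 k e he]
  have hσo : ∀ k, other (σ k) = other k := by
    intro k
    refine Prod.ext (funext fun e => hσr k e) (funext fun i => Prod.ext (funext fun j => ?_)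
      (funext fun j => ?_))
    · change (σ k _).e = (k _).e
      rw [hσ2]
      exact fun hij => i.2.1 (congrArg Prod.fst (congrArg Subtype.val hij))
    · change (σ k _).d = (k _).d
      rw [hσ2]
      exact fun hij => i.2.2 (congrArg Prod.snd (congrArg Subtype.val hij))
  have hσE : ∀ k m, (randomMatrixScheme F E L N hN).Enc a b h (partyKey (σ k) a) m C' =
      (randomMatrixScheme F E L N hN).Enc a b h (partyKey k a) m C := by
    intro k m
    refine (indepPMF_apply _ C').trans (Eq.trans ?_ (indepPMF_apply _ C).symm)
    refine prod_congr rfl fun e _ => ?_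
    by_cases he : e = ⟨(a, b), h⟩
    · subst he
      rw [if_pos rfl, if_pos rfl, PMF.pure_apply, PMF.pure_apply]
      congr 1
      have hgm := KeyTriple.mulNZ_twist_eq_iff (by lia) (k ⟨(a, b), h⟩) m hg
      rw [← hσ1] at hgm
      exact propext (by rw [eq_comm, eq_comm (a := C _)]; exact hgm)
    · rw [if_neg he, if_neg he]
      exact (PMF.uniformOfFintype_apply _).trans (PMF.uniformOfFintype_apply _).symm
  have hpair : ∀ (p : PMF (randomMatrixScheme F E L N hN).Cipher) z C,
      p.map (fun C => (C, z)) (C, y) = if z = y then p C else 0 := by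
    intro p z C
    rw [PMF.map_apply, tsum_eq_single C]
    · simp [eq_comm]
    · intro C' hC'
      rw [if_neg]
      intro hC
      exact hC' (congrArg Prod.fst hC).symm
  rw [hlaw, PMF.bind_apply, PMF.bind_apply, ← σ.tsum_eq fun k => _ * _]
  refine tsum_congr fun k => ?_
  congr 1
  · simp only [indepPMF_apply, pairKeyGen_apply]
  · rw [PMF.bind_apply, PMF.bind_apply]
    refine tsum_congr fun m => ?_
    rw [hpair, hpair, hσo, hσE]

/-- Statistical distance between the attack and the ideal law, when on every edge the leaker's view
amounts to both `E` and `D` and the listener's to `E`, or the leaker's to `D` and the listener's to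
both. -/
theorem SD_attackLaw_idealLaw_le {I A B : Type*} [Fintype I] [Finite A] [Finite B]
    [Nonempty (NZ F N)] (hL : 1 ≤ L) (hN : 2 * L < N) (keys : PMF (I → KeyTriple F L N))
    (hkeys : ∀ k, (keys k).toReal = ∏ _i : I, (1 / Fintype.card (KeyTriple F L N) : ℝ))
    (α : I → KeyTriple F L N → A) (β : I → KeyTriple F L N → B)
    (att : (I → A) → PMF (I → NZ F N))
    (h : ∀ i, (∀ s t, (α i s = α i t ↔ s.e = t.e ∧ s.d = t.d) ∧ (β i s = β i t ↔ s.e = t.e)) ∨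
      (∀ s t, (α i s = α i t ↔ s.d = t.d) ∧ (β i s = β i t ↔ s.e = t.e ∧ s.d = t.d))) :
    SD (attackLaw keys α β (fun t c => mulNZ le_rfl t.r c) att) (idealLaw keys β) ≤
      2 * Fintype.card I * (Fintype.card F : ℝ) ^ (-((N : ℝ) / 2 - (L : ℝ))) := by
  have hLN : L ≤ N := by lia
  have := Fintype.ofFinite A
  have := Fintype.ofFinite B
  have : Nonempty (KeyTriple F L N) := nonempty_keyTriple hLN
  have hbound : ∀ i, ∃ M : A → A → ℝ, (∀ a a' (c c' : NZ F N),
      (∑ t with α i t = a, (Fintype.card (NZ F N) : ℝ) *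
        #{s | (α i s = a' ∧ β i s = β i t) ∧ mulNZ le_rfl s.r c' = mulNZ le_rfl t.r c} /
          #{s | β i s = β i t}) / Fintype.card (KeyTriple F L N) ≤ M a a') ∧
      ∑ a, ∑ a', M a a' ≤ 1 + 3 * leak F L N := by
    intro i
    rcases h i with hi | hi
    · exact KeyTriple.exists_collision_bound_of_sender hL hN (α i) (β i)
        (fun s t => (hi s t).1) (fun s t => (hi s t).2)
    · exact KeyTriple.exists_collision_bound_of_not_sender hL hN (α i) (β i)
        (fun s t => (hi s t).1) (fun s t => (hi s t).2)
  choose M hM1 hM2 using hbound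
  have hchi := sq_sum_abs_attackLaw_sub_idealLaw_le keys hkeys α β
    (fun t c => mulNZ le_rfl t.r c) att M (fun i a a' c c' => by convert hM1 i a a' c c')
  have hq : (0 : ℝ) < Fintype.card F := by exact_mod_cast Fintype.card_pos
  have hleak : leak F L N = ((Fintype.card F : ℝ) ^ (-((N : ℝ) / 2 - (L : ℝ)))) ^ 2 := by
    rw [leak, ← Real.rpow_natCast, ← Real.rpow_natCast, ← Real.rpow_natCast, ← Real.rpow_mul hq.le,
      ← Real.rpow_sub hq, Nat.cast_sub hLN]
    congr 1
    push_cast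
    ring
  rw [SD_eq_sum]
  refine half_le_of_sq_le (by positivity) (sum_abs_sub_le_two _ _) (hchi.trans ?_)
  rw [← hleak]
  have hM0 : ∀ i, 0 ≤ ∑ a, ∑ a', M i a a' := by
    intro i
    refine sum_nonneg fun a _ => sum_nonneg fun a' _ => ?_
    refine le_trans ?_ (hM1 i a a' (Classical.arbitrary _) (Classical.arbitrary _))
    exact div_nonneg (sum_nonneg fun t _ => div_nonneg
      (mul_nonneg (Nat.cast_nonneg _) (Nat.cast_nonneg _)) (Nat.cast_nonneg _)) (Nat.cast_nonneg _)
  have := prod_le_prod (s := univ) (fun i _ => hM0 i) (fun i _ => hM2 i)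
  rw [prod_const, card_univ] at this
  linarith

/-- The keys of leaker and listener are functions of the more informative views `α` and `β`, so that
the bound for these views applies by data processing. -/
theorem noWrite (hL : 1 ≤ L) (hN : 2 * L < N) : (randomMatrixScheme F E L N hN).NoWrite
    (2 * (E.card : ℝ) * (Fintype.card F : ℝ) ^ (-((N : ℝ) / 2 - (L : ℝ)))) := by
  intro A B hAB Att
  have hLN : L ≤ N := by lia
  obtain ⟨t₀⟩ : Nonempty (KeyTriple F L N) := nonempty_keyTriple hLN
  have : Nonempty (NZ F N) := nonempty_NZ (by lia)
  set α : E → KeyTriple F L N → Option (FR F N L) × FR F L N := fun e t =>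
    (if e.1.1 ∈ A then some t.e else none, t.d) with hα
  set β : E → KeyTriple F L N → FR F N L × Option (FR F L N) := fun e t =>
    (t.e, if e.1.1 ∈ A then none else some t.d) with hβ
  -- The default values of `getD` are never reached: all senders in `A` contribute `some`, and
  -- nobody in `A` may send to anybody in `B`.
  let fA : (E → Option (FR F N L) × FR F L N) → (randomMatrixScheme F E L N hN).KeysOf A :=
    fun a i => (fun j => (a ⟨(i.1, j.1), j.2⟩).1.getD t₀.e, fun j => (a ⟨(j.1, i.1), j.2⟩).2)
  let fB : (E → FR F N L × Option (FR F L N)) → (randomMatrixScheme F E L N hN).KeysOf B :=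
    fun b i => (fun j => (b ⟨(i.1, j.1), j.2⟩).1, fun j => (b ⟨(j.1, i.1), j.2⟩).2.getD t₀.d)
  have hA : ∀ k : E → KeyTriple F L N, (fun i : A => partyKey k i.1) =
      fA fun e => α e (k e) := by
    intro k
    refine funext fun i => Prod.ext (funext fun j => ?_) rfl
    simp [fA, hα, partyKey]
  have hB : ∀ k : E → KeyTriple F L N, (fun i : B => partyKey k i.1) =
      fB fun e => β e (k e) := by
    intro k
    refine funext fun i => Prod.ext rfl (funext fun j => ?_)
    have hj : j.1 ∉ A := fun hj => hAB j.1 hj i.1 i.2 j.2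
    simp [fB, hβ, partyKey, hj]
  let φ : (E → NZ F N × FR F N L × Option (FR F L N)) →
      (randomMatrixScheme F E L N hN).SCipher × (randomMatrixScheme F E L N hN).KeysOf B :=
    fun z => (fun e => (z e).1, fB fun e => (z e).2)
  set keys := keysLaw F E L N hLN with hkeys
  have hreal : (randomMatrixScheme F E L N hN).writeLaw A B Att =
      (attackLaw keys α β (fun t c => mulNZ le_rfl t.r c) fun a => Att (fA a)).map φ := by
    rw [Scheme.writeLaw, keyGen_bind]
    refine Eq.trans (congrArg _ (funext fun k => ?_)) (PMF.map_bind _ _ _).symm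
    refine Eq.trans ?_ (PMF.map_comp _ _ _).symm
    refine Eq.trans ?_ (PMF.bind_pure_comp _ _)
    refine congr (congrArg PMF.bind (congrArg Att (hA k))) (funext fun C => ?_)
    refine (PMF.pure_map _ _).trans (congrArg PMF.pure (Prod.ext rfl ?_))
    exact hB k
  have hideal : prodPMF (PMF.uniformOfFintype (randomMatrixScheme F E L N hN).SCipher)
      ((randomMatrixScheme F E L N hN).keyLaw B) = (idealLaw (X := NZ F N) keys β).map φ := by
    have hK : (randomMatrixScheme F E L N hN).keyLaw B =
        keys.map fun k => fB fun e => β e (k e) := by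
      rw [Scheme.keyLaw, keyGen_map]
      exact congrArg (fun f => keys.map f) (funext hB)
    rw [hK]
    refine Eq.trans ?_ (idealLaw_map (X := NZ F N) keys β fB).symm
    exact congrArg (prodPMF · _) (uniformOfFintype_congr _ _)
  rw [hreal, hideal]
  have hfin : Finite ((randomMatrixScheme F E L N hN).SCipher ×
      (randomMatrixScheme F E L N hN).KeysOf B) :=
    inferInstanceAs (Finite ((E → NZ F N) × ∀ i : B,
      ({j : Fin n // (i.1, j) ∈ E} → FR F N L) × ({j : Fin n // (j, i.1) ∈ E} → FR F L N)))
  refine (SD_map_le _ _ φ).trans ?_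
  rw [← Fintype.card_coe E]
  refine SD_attackLaw_idealLaw_le hL hN keys (fun k => ?_) α β _ fun e => ?_
  · rw [hkeys, indepPMF_apply, ENNReal.toReal_prod]
    simp [pairKeyGen_apply]
  · by_cases he : e.1.1 ∈ A
    · exact Or.inl fun s t => by simp [hα, hβ, he]
    · exact Or.inr fun s t => by simp [hα, hβ, he]

end Scheme

end ACE

end

/-- Let `F` be a finite field of order `q`, `L ≥ 1`, `N > 2L`. For every policy `E` on `n` parties,
the random matrix scheme is correct, satisfies the perfect no-read rule, and satisfies the no-write
rule with distance parameter `2 |E| q ^ (-(N/2 - L))`. -/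
theorem theorem2 {F : Type*} [Field F] [Fintype F] (n : ℕ) (E : Finset (Fin n × Fin n))
    (L N : ℕ) (hL : 1 ≤ L) (hN : 2 * L < N) :
    (ACE.randomMatrixScheme F E L N hN).Correct ∧
    (ACE.randomMatrixScheme F E L N hN).PerfectNoRead ∧
    (ACE.randomMatrixScheme F E L N hN).NoWrite
      (2 * (E.card : ℝ) * (Fintype.card F : ℝ) ^ (-((N : ℝ) / 2 - (L : ℝ)))) := by
  exact ⟨ACE.correct hN, ACE.perfectNoRead hN, ACE.noWrite hL hN⟩
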